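/- Let $\sigma=(\sigma_1,\sigma_2,\sigma_3)$ be the Pauli matrices, $\alpha_j=\begin{pmatrix}0&\sigma_j\\ \sigma_j&0\end{pmatrix}$, $\beta=\begin{pmatrix}I_2&0\\0&-I_2\end{pmatrix}$, $D=\frac1i\nabla$, $\langle x\rangle=\sqrt{1+|x|^2}$ and $m>0$. Assume (A1): $A=(A_1,A_2,A_3)$ is a vector potential on $\mathbb R^3$ whose components are real-valued measurable functions with $|A_j(x)|\le C\langle x\rangle^{-\rho}$ for some constants $C>0$ and $\rho>1$. Let $T=\sigma\cdot(D-A(x))$ be the Weyl–Dirac operator in $[L^2(\mathbb R^3)]^2$ with domain $[H^1(\mathbb R^3)]^2$, and let $H=\alpha\cdot(D-A(x))+m\beta$ be the Dirac operator in $[L^2(\mathbb R^3)]^4$ with domain $[H^1(\mathbb R^3)]^4$. For $\psi\in\operatorname{Ker}(T)$ and $\omega\in\mathbb S^2$ put $$u_\psi(\omega)=\frac{i}{4\pi}\int_{\mathbb R^3}\big\{(\omega\cdot A(y))\,I_2+i\,\sigma\cdot(\omega\times A(y))\big\}\psi(y)\,dy .$$ (i) If $f\in\operatorname{Ker}(H-m)$,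 then $f=\binom{\psi}{0}$ for some $\psi\in\operatorname{Ker}(T)$, the integral defining $u_\psi(\omega)$ converges absolutely for every $\omega\in\mathbb S^2$, $u_\psi$ is continuous on $\mathbb S^2$, $f$ is (after modification on a null set) continuous on $\mathbb R^3$, and $$\lim_{r\to+\infty}r^2f(r\omega)=\binom{u_\psi(\omega)}{0}$$ uniformly with respect to $\omega\in\mathbb S^2$. (ii) If $f\in\operatorname{Ker}(H+m)$, then $f=\binom{0}{\psi}$ for some $\psi\in\operatorname{Ker}(T)$, the integral defining $u_\psi(\omega)$ converges absolutely for every $\omega\in\mathbb S^2$, $u_\psi$ is continuous on $\mathbb S^2$, $f$ is (after modification on a null set) continuous on $\mathbb R^3$, and $$\lim_{r\to+\infty}r^2f(r\omega)=\binom{0}{u_\psi(\omega)}$$ uniformly with respect to $\omega\in\mathbb S^2$. -/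

import Mathlib

open MeasureTheory Filter
open scoped SchwartzMap ENNReal Matrix LineDeriv

noncomputable section

namespace WeylDirac

/-- Physical space `ℝ³` with the Euclidean norm. -/
abbrev Space : Type := EuclideanSpace ℝ (Fin 3)

/-- Spinors with components indexed by `ι`: the Hilbert space `ℂ^ι`. -/
abbrev Spinor (ι : Type) [Fintype ι] : Type := EuclideanSpace ℂ ι

/-- The Hilbert space `L²(ℝ³; ℂ^ι) = [L²(ℝ³)]^ι`. -/
abbrev L2 (ι : Type) [Fintype ι] : Type := Lp (Spinor ι) 2 (volume : Measure Space)

/-- The Pauli matrices `σ₁, σ₂, σ₃`. -/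
def pauli : Fin 3 → Matrix (Fin 2) (Fin 2) ℂ :=
  ![!![0, 1; 1, 0], !![0, -Complex.I; Complex.I, 0], !![1, 0; 0, -1]]

/-- The Dirac matrices `α_j`, in `2 × 2` blocks. -/
def diracAlpha (j : Fin 3) : Matrix (Fin 2 ⊕ Fin 2) (Fin 2 ⊕ Fin 2) ℂ :=
  Matrix.fromBlocks 0 (pauli j) (pauli j) 0

/-- The Dirac matrix `β`, in `2 × 2` blocks. -/
def diracBeta : Matrix (Fin 2 ⊕ Fin 2) (Fin 2 ⊕ Fin 2) ℂ :=
  Matrix.fromBlocks 1 0 0 (-1)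

/-- Assumption (A1): the components of the vector potential `A` are real-valued (Lebesgue)
measurable functions with `|A_j(x)| ≤ C ⟨x⟩^(-ρ)` for some `ρ > 1`, where `⟨x⟩ = √(1 + |x|²)`. -/
structure AssumptionA1 (A : Space → Space) : Prop where
  aemeasurable : ∀ j, AEMeasurable (fun x => A x j) volume
  bound : ∃ ρ : ℝ, 1 < ρ ∧ ∃ C : ℝ, 0 < C ∧
    ∀ j x, |A x j| ≤ C * Real.sqrt (1 + ‖x‖ ^ 2) ^ (-ρ)

/-- Under (A1) every component of `A` is essentially bounded. -/
theorem AssumptionA1.memLp_top {A : Space → Space} (hA : AssumptionA1 A) (j : Fin 3) :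
    MemLp (fun x => (A x j : ℂ)) ∞ (volume : Measure Space) := by
  obtain ⟨ρ, hρ, C, hC, h⟩ := hA.bound
  refine memLp_top_of_bound
    (Complex.measurable_ofReal.comp_aemeasurable (hA.aemeasurable j)).aestronglyMeasurable C
    (Eventually.of_forall fun x => ?_)
  rw [Complex.norm_real, Real.norm_eq_abs]
  refine (h j x).trans (mul_le_of_le_one_right hC.le ?_)
  exact Real.rpow_le_one_of_one_le_of_nonpos
    (Real.one_le_sqrt.2 (by nlinarith [sq_nonneg ‖x‖])) (by linarith)

section Operators

variable {ι : Type} [Fintype ι]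

theorem toTemperedDistribution_injective :
    Function.Injective (Lp.toTemperedDistributionCLM (Spinor ι) (volume : Measure Space) 2) :=
  LinearMap.ker_eq_bot.1 Lp.ker_toTemperedDistributionCLM_eq_bot

variable (ι) in
/-- The Sobolev space `[H¹(ℝ³)]^ι` as a subspace of `[L²(ℝ³)]^ι`. -/
def sobolevH1 : Submodule ℂ (L2 ι) where
  carrier := {f | TemperedDistribution.MemSobolev 1 2 (f : 𝓢'(Space, Spinor ι))}
  zero_mem' := by
    have h := TemperedDistribution.memSobolev_fun_zero Space (Spinor ι) 1 2
    rw [← map_zero (Lp.toTemperedDistributionCLM (Spinor ι) (volume : Measure Space) 2)] at h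
    exact h
  add_mem' := by
    intro f g hf hg
    have h := TemperedDistribution.MemSobolev.add hf hg
    simp only [← Lp.toTemperedDistributionCLM_apply, ← map_add] at h
    exact h
  smul_mem' := by
    intro c f hf
    have h := TemperedDistribution.MemSobolev.smul c hf
    simp only [← Lp.toTemperedDistributionCLM_apply, ← map_smul] at h
    exact h

theorem exists_weakDeriv (j : Fin 3) (f : sobolevH1 ι) :
    ∃ g : L2 ι, (g : 𝓢'(Space, Spinor ι)) =
      ∂_{EuclideanSpace.single j (1 : ℝ)} ((f : L2 ι) : 𝓢'(Space, Spinor ι)) := by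
  have h := TemperedDistribution.MemSobolev.lineDerivOp
    (m := EuclideanSpace.single j (1 : ℝ)) f.2
  rw [sub_self, TemperedDistribution.memSobolev_zero_iff] at h
  obtain ⟨g, hg⟩ := h
  exact ⟨g, hg.symm⟩

/-- The weak partial derivative `∂_j : [H¹]^ι → [L²]^ι`: the `L²` function representing the
distributional derivative. -/
def weakDeriv (j : Fin 3) : sobolevH1 ι →ₗ[ℂ] L2 ι where
  toFun f := (exists_weakDeriv j f).choose
  map_add' f g := by
    apply toTemperedDistribution_injective
    rw [map_add]
    simp only [Lp.toTemperedDistributionCLM_apply, (exists_weakDeriv j _).choose_spec]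
    rw [← LineDeriv.lineDerivOp_add]
    simp only [← Lp.toTemperedDistributionCLM_apply, ← map_add, Submodule.coe_add]
  map_smul' c f := by
    apply toTemperedDistribution_injective
    rw [map_smul]
    simp only [Lp.toTemperedDistributionCLM_apply, (exists_weakDeriv j _).choose_spec,
      RingHom.id_apply]
    rw [← LineDeriv.lineDerivOp_smul]
    simp only [← Lp.toTemperedDistributionCLM_apply, ← map_smul, Submodule.coe_smul]

/-- The operator `D_j = (1/i) ∂_j : [H¹]^ι → [L²]^ι`. -/
def momentum (j : Fin 3) : sobolevH1 ι →ₗ[ℂ] L2 ι :=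
  (1 / Complex.I) • weakDeriv j

/-- Multiplication by the component `A_j` of the vector potential on `[L²]^ι`. -/
def mulPotential {A : Space → Space} (hA : AssumptionA1 A) (j : Fin 3) : L2 ι →ₗ[ℂ] L2 ι where
  toFun f := (hA.memLp_top j).toLp _ • f
  map_add' f g := Lp.add_smul _ f g
  map_smul' c f := (Lp.smul_comm c _ f).symm

variable [DecidableEq ι]

/-- Pointwise multiplication by a constant matrix on `[L²]^ι`. -/
def mulMatrix (M : Matrix ι ι ℂ) : L2 ι →ₗ[ℂ] L2 ι :=
  ((Matrix.toEuclideanCLM (n := ι) (𝕜 := ℂ) M).compLpL 2 (volume : Measure Space)).toLinearMap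

/-- The operator `∑_j a_j (D_j - A_j) + b` in `[L²]^ι` with domain `[H¹]^ι`. -/
def firstOrderOperator {A : Space → Space} (hA : AssumptionA1 A)
    (a : Fin 3 → Matrix ι ι ℂ) (b : Matrix ι ι ℂ) : L2 ι →ₗ.[ℂ] L2 ι where
  domain := sobolevH1 ι
  toFun := (∑ j, mulMatrix (a j) ∘ₗ (momentum j - mulPotential hA j ∘ₗ (sobolevH1 ι).subtype))
    + mulMatrix b ∘ₗ (sobolevH1 ι).subtype

end Operators

/-- The Weyl–Dirac operator `T = σ·(D - A)` with domain `[H¹]²`. -/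
def weylDirac {A : Space → Space} (hA : AssumptionA1 A) : L2 (Fin 2) →ₗ.[ℂ] L2 (Fin 2) :=
  firstOrderOperator hA pauli 0

/-- The Dirac operator `H = α·(D - A) + m β` with domain `[H¹]⁴`. -/
def dirac (m : ℝ) {A : Space → Space} (hA : AssumptionA1 A) :
    L2 (Fin 2 ⊕ Fin 2) →ₗ.[ℂ] L2 (Fin 2 ⊕ Fin 2) :=
  firstOrderOperator hA diracAlpha ((m : ℂ) • diracBeta)

/-- `Ker(T - c)`, as a subspace of the ambient space, for a partially defined operator `T`. -/
def kerSub {E : Type} [AddCommGroup E] [Module ℂ E] (T : E →ₗ.[ℂ] E) (c : ℂ) : Submodule ℂ E :=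
  (LinearMap.ker (T.toFun - c • T.domain.subtype)).map T.domain.subtype

/-- The four-spinor `(v, 0)`. -/
def upper (v : Spinor (Fin 2)) : Spinor (Fin 2 ⊕ Fin 2) := WithLp.toLp 2 (Sum.elim v.ofLp 0)

/-- The four-spinor `(0, v)`. -/
def lower (v : Spinor (Fin 2)) : Spinor (Fin 2 ⊕ Fin 2) := WithLp.toLp 2 (Sum.elim 0 v.ofLp)

/-- The matrix `(w·a) I₂ + i σ·(w × a)`. -/
def profileMatrix (w a : Space) : Matrix (Fin 2) (Fin 2) ℂ :=
  ((w.ofLp ⬝ᵥ a.ofLp : ℝ) : ℂ) • (1 : Matrix (Fin 2) (Fin 2) ℂ)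
    + Complex.I • ∑ j, (((w.ofLp ⨯₃ a.ofLp) j : ℝ) : ℂ) • pauli j

/-- The integrand `{(ω·A(y)) I₂ + i σ·(ω × A(y))} ψ(y)`. -/
def profileIntegrand (A : Space → Space) (ψ : L2 (Fin 2)) (w : Space) (y : Space) :
    Spinor (Fin 2) :=
  WithLp.toLp 2 (profileMatrix w (A y) *ᵥ (ψ y).ofLp)

/-- The limit profile
`u_ψ(ω) = (i / 4π) ∫ {(ω·A(y)) I₂ + i σ·(ω × A(y))} ψ(y) dy` on the unit sphere. -/
def limitProfile (A : Space → Space) (ψ : L2 (Fin 2)) (w : Metric.sphere (0 : Space) 1) :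
    Spinor (Fin 2) :=
  (Complex.I / (4 * Real.pi)) • ∫ y, profileIntegrand A ψ w y

end WeylDirac

end

/-!
A function in `Ker(H ∓ m)` has the form `f = (φ, χ)`, and the eigenvalue equation reads
`T χ = 0`, `T φ = 2 m χ` for the upper sign and `T φ = 0`, `T χ = -2 m φ` for the lower one. Since
`T` is symmetric, `2 m ‖χ‖² = ⟨T φ, χ⟩ = ⟨φ, T χ⟩ = 0` in the first case, so `χ = 0` and `φ` is a
zero mode; the second case is alike (`weylDirac_eq_zero_of_apply_eq_smul`). Symmetry of the free
part is integration by parts for weak derivatives in `L²` (`IsWeakDeriv.inner_eq_neg`), which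
Plancherel's theorem provides.

A zero mode satisfies `σ·D ψ = h` with `h = (σ·A) ψ`. The operator `σ·D` has the fundamental
solution `(i / 4π) |x|⁻³ σ·x`, which gives the representation
`ψ(x) = (i / 4π) ∫ |x - y|⁻³ σ·(x - y) h(y) dy` (`ae_eq_potential`). It is obtained from the
regularised kernel `(|z|² + t)^(-3/2) σ·z`: this kernel is smooth and square integrable together
with its first derivatives, its curl vanishes, and its divergence `3t (|z|² + t)^(-5/2)` is an
approximate identity of mass `4π` as `t → 0`.

The representation bounds `|ψ|` by the Riesz potential of order one of `⟨y⟩^(-ρ) |ψ|`. Starting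
from `ψ ∈ L²`, two applications give boundedness (`exists_ae_le_of_le_riesz`), and each further one
improves the decay rate by a fixed `δ ≤ ρ - 1`, up to nearly `2`
(`exists_ae_le_powKernel_of_le_riesz`). The outcome is that `h` is bounded and
`h(y) = O(|y|^(-a))` for some `a > 3` (`exists_density_bound`), so that `h` is integrable.

For such a density the potential is continuous (`continuous_potential`), and `r²` times its value
at `r ω` converges to `∫ σ·ω h(y) dy`, uniformly in `ω` (`tendstoUniformly_potential`). The product
rule `(σ·ω)(σ·a) = (ω·a) I₂ + i σ·(ω × a)` turns this limit into `u_ψ(ω)`.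
-/

noncomputable section

namespace WeylDirac

/-! ### Weak derivatives in `L²` -/

section WeakDerivative

open FourierTransform

variable {ι κ : Type} [Fintype ι] [Fintype κ]

/-- `g` is the distributional derivative of `f` in the direction `m`. -/
def IsWeakDeriv (m : Space) (f g : L2 ι) : Prop :=
  (g : 𝓢'(Space, Spinor ι)) = ∂_{m} (f : 𝓢'(Space, Spinor ι))

theorem isWeakDeriv_iff {m : Space} {f g : L2 ι} : IsWeakDeriv m f g ↔
    ∀ φ : 𝓢(Space, ℂ), ∫ x, φ x • g x = -∫ x, (∂_{m} φ) x • f x := by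
  have key : ∀ φ : 𝓢(Space, ℂ), (∂_{m} (f : 𝓢'(Space, Spinor ι))) φ
      = -∫ x, (∂_{m} φ) x • f x := fun φ => by
    rw [TemperedDistribution.lineDerivOp_apply_apply, map_neg, Lp.toTemperedDistribution_apply]
  constructor
  · intro h φ
    rw [← key, ← (show _ = _ from h), Lp.toTemperedDistribution_apply]
  · intro h
    refine DFunLike.ext _ _ fun φ => ?_
    rw [key, Lp.toTemperedDistribution_apply, h]

theorem isWeakDeriv_weakDeriv (j : Fin 3) (f : sobolevH1 ι) :
    IsWeakDeriv (EuclideanSpace.single j 1) (f : L2 ι) (weakDeriv j f) :=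
  (exists_weakDeriv j f).choose_spec

theorem IsWeakDeriv.unique {m : Space} {f g g' : L2 ι} (h : IsWeakDeriv m f g)
    (h' : IsWeakDeriv m f g') : g = g' :=
  toTemperedDistribution_injective ((show _ = _ from h).trans (show _ = _ from h').symm)

theorem integrable_schwartz_smul (φ : 𝓢(Space, ℂ)) (f : L2 ι) :
    Integrable (fun x => φ x • f x) :=
  memLp_one_iff_integrable.1 ((Lp.memLp f).smul (φ.memLp 2 volume))

theorem integral_smul_compLp (B : Spinor ι →L[ℂ] Spinor κ) (φ : 𝓢(Space, ℂ)) (f : L2 ι) :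
    ∫ x, φ x • (B.compLp f) x = B (∫ x, φ x • f x) := by
  rw [← B.integral_comp_comm (integrable_schwartz_smul φ f)]
  refine integral_congr_ae ?_
  filter_upwards [B.coeFn_compLp f] with x hx
  rw [hx, map_smul]

theorem IsWeakDeriv.compLp {m : Space} {f g : L2 ι} (h : IsWeakDeriv m f g)
    (B : Spinor ι →L[ℂ] Spinor κ) : IsWeakDeriv m (B.compLp f) (B.compLp g) := by
  rw [isWeakDeriv_iff] at h ⊢
  intro φ
  rw [integral_smul_compLp, integral_smul_compLp, h, map_neg]

theorem compLp_mem_sobolevH1 (B : Spinor ι →L[ℂ] Spinor κ) {f : L2 ι} (hf : f ∈ sobolevH1 ι) :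
    B.compLp f ∈ sobolevH1 κ := by
  obtain ⟨g, hg⟩ := hf
  refine ⟨B.compLp g, DFunLike.ext _ _ fun φ => ?_⟩
  have h := DFunLike.congr_fun hg φ
  have key : ∀ {ν : Type} [Fintype ν] (u : L2 ν),
      (TemperedDistribution.besselPotential Space (Spinor ν) 1 (u : 𝓢'(Space, Spinor ν))) φ =
        ∫ x, (𝓕 (SchwartzMap.smulLeftCLM ℂ (fun x : Space =>
            (((1 + ‖x‖ ^ 2) ^ ((1 : ℝ) / 2) : ℝ) : ℂ))
          (𝓕⁻ φ))) x • u x := by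
    intro ν _ u
    rw [← Lp.toTemperedDistribution_apply]
    rfl
  rw [key, Lp.toTemperedDistribution_apply] at h
  rw [key, Lp.toTemperedDistribution_apply, integral_smul_compLp, integral_smul_compLp, h]

/-- On the Fourier side a weak derivative is multiplication by `2πi ⟨x, m⟩`. -/
theorem IsWeakDeriv.fourier_ae_eq {m : Space} {f g : L2 ι} (h : IsWeakDeriv m f g) :
    ∀ᵐ x, (𝓕 g : L2 ι) x =
      (2 * Real.pi * Complex.I * (inner ℝ x m : ℝ) : ℂ) • (𝓕 f : L2 ι) x := by
  have h1 : ((𝓕 g : L2 ι) : 𝓢'(Space, Spinor ι)) = (2 * Real.pi * Complex.I) •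
      TemperedDistribution.smulLeftCLM (Spinor ι) (fun x : Space => ((inner ℝ x m : ℝ) : ℂ))
        ((𝓕 f : L2 ι) : 𝓢'(Space, Spinor ι)) := by
    rw [← Lp.fourier_toTemperedDistribution_eq, ← Lp.fourier_toTemperedDistribution_eq,
      (show _ = _ from h), TemperedDistribution.fourier_lineDerivOp_eq]
  have hint : ∀ u : L2 ι, LocallyIntegrable u volume := fun u =>
    (Lp.memLp u).locallyIntegrable (by norm_num)
  have hcont : Continuous fun x : Space => (2 * Real.pi * Complex.I * (inner ℝ x m : ℝ) : ℂ) := by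
    fun_prop
  -- the identity `h1` of distributions, tested against real bump functions, is one of functions
  refine ae_eq_of_integral_contDiff_smul_eq (hint _) ?_ fun φ hφ hφc => ?_
  · have := (hint (𝓕 f : L2 ι)).locallyIntegrableOn Set.univ
    exact locallyIntegrableOn_univ.1 (this.continuousOn_smul isOpen_univ.isLocallyClosed
      hcont.continuousOn)
  · have hφ' : ContDiff ℝ (⊤ : ℕ∞) (fun x => (φ x : ℂ)) := Complex.ofRealCLM.contDiff.comp hφ
    have hφc' : HasCompactSupport (fun x => (φ x : ℂ)) :=
      hφc.comp_left (g := fun t : ℝ => (t : ℂ)) Complex.ofReal_zero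
    have h2 := DFunLike.congr_fun h1 (hφc'.toSchwartzMap hφ')
    rw [Lp.toTemperedDistribution_apply] at h2
    have ht : (fun x : Space => ((inner ℝ x m : ℝ) : ℂ)).HasTemperateGrowth := by fun_prop
    have happ : ∀ x, hφc'.toSchwartzMap hφ' x = (φ x : ℂ) := fun _ => rfl
    simp only [happ] at h2
    simp only [← Complex.coe_smul]
    rw [h2]
    change (2 * Real.pi * Complex.I) • (TemperedDistribution.smulLeftCLM (Spinor ι) _ _) _ = _
    rw [TemperedDistribution.smulLeftCLM_apply_apply, Lp.toTemperedDistribution_apply,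
      ← integral_smul]
    refine integral_congr_ae (Eventually.of_forall fun x => ?_)
    simp only [SchwartzMap.smulLeftCLM_apply_apply ht, happ,
      smul_smul, smul_eq_mul]
    congr 1
    ring

/-- Integration by parts: weak differentiation is antisymmetric on `L²`. -/
theorem IsWeakDeriv.inner_eq_neg {m : Space} {f g f' g' : L2 ι} (h : IsWeakDeriv m f g)
    (h' : IsWeakDeriv m f' g') : inner ℂ g f' = -inner ℂ f g' := by
  rw [← Lp.inner_fourier_eq g f', ← Lp.inner_fourier_eq f g', L2.inner_def, L2.inner_def,
    ← integral_neg]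
  refine integral_congr_ae ?_
  filter_upwards [h.fourier_ae_eq, h'.fourier_ae_eq] with x hx hx'
  rw [hx, hx', inner_smul_left, inner_smul_right]
  simp only [map_mul, Complex.conj_I, Complex.conj_ofReal, map_ofNat]
  ring

end WeakDerivative

/-! ### Reduction from the Dirac operator to the Weyl–Dirac operator -/

section Reduction

variable {ι κ : Type} [Fintype ι] [Fintype κ]

theorem compLp_smul (B : Spinor ι →L[ℂ] Spinor κ) (c : ℂ) (f : L2 ι) :
    B.compLp (c • f) = c • B.compLp f :=
  (B.compLpL 2 (volume : Measure Space)).map_smul c f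

theorem compLp_add (B : Spinor ι →L[ℂ] Spinor κ) (f g : L2 ι) :
    B.compLp (f + g) = B.compLp f + B.compLp g :=
  (B.compLpL 2 (volume : Measure Space)).map_add f g

theorem compLp_sub (B : Spinor ι →L[ℂ] Spinor κ) (f g : L2 ι) :
    B.compLp (f - g) = B.compLp f - B.compLp g :=
  (B.compLpL 2 (volume : Measure Space)).map_sub f g

theorem compLp_sum (B : Spinor ι →L[ℂ] Spinor κ) (f : Fin 3 → L2 ι) :
    B.compLp (∑ j, f j) = ∑ j, B.compLp (f j) :=
  map_sum (B.compLpL 2 (volume : Measure Space)) f _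

theorem zero_compLp (f : L2 ι) : (0 : Spinor ι →L[ℂ] Spinor κ).compLp f = 0 := by
  refine Lp.ext ?_
  filter_upwards [(0 : Spinor ι →L[ℂ] Spinor κ).coeFn_compLp f,
    Lp.coeFn_zero (Spinor κ) 2 (volume : Measure Space)] with x h1 h2
  rw [h1, h2]; rfl

theorem compLp_comp {ν : Type} [Fintype ν] (B : Spinor ι →L[ℂ] Spinor κ)
    (C : Spinor κ →L[ℂ] Spinor ν) (f : L2 ι) :
    C.compLp (B.compLp f) = (C ∘L B).compLp f := by
  refine Lp.ext ?_
  filter_upwards [C.coeFn_compLp (B.compLp f), B.coeFn_compLp f, (C ∘L B).coeFn_compLp f]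
    with x h1 h2 h3
  rw [h1, h2, h3]; rfl

variable {A : Space → Space} (hA : AssumptionA1 A)

theorem coeFn_mulPotential (j : Fin 3) (f : L2 ι) :
    ∀ᵐ x, mulPotential hA j f x = (A x j : ℂ) • f x := by
  filter_upwards [Lp.coeFn_lpSMul (r := 2) ((hA.memLp_top j).toLp _) f, (hA.memLp_top j).coeFn_toLp]
    with x h1 h2
  have : mulPotential hA j f x = ((hA.memLp_top j).toLp _ • f) x := rfl
  rw [this, h1, Pi.smul_apply', h2]

theorem compLp_mulPotential (B : Spinor ι →L[ℂ] Spinor κ) (j : Fin 3) (f : L2 ι) :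
    B.compLp (mulPotential hA j f) = mulPotential hA j (B.compLp f) := by
  refine Lp.ext ?_
  filter_upwards [B.coeFn_compLp (mulPotential hA j f), coeFn_mulPotential hA j f,
    coeFn_mulPotential hA j (B.compLp f), B.coeFn_compLp f] with x h1 h2 h3 h4
  rw [h1, h2, h3, h4, map_smul]

theorem compLp_weakDeriv (B : Spinor ι →L[ℂ] Spinor κ) (j : Fin 3) (f : sobolevH1 ι) :
    B.compLp (weakDeriv j f) = weakDeriv j ⟨B.compLp f, compLp_mem_sobolevH1 B f.2⟩ :=
  ((isWeakDeriv_weakDeriv j f).compLp B).unique (isWeakDeriv_weakDeriv j _)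

theorem inner_mulPotential (j : Fin 3) (f g : L2 ι) :
    inner ℂ (mulPotential hA j f) g = inner ℂ f (mulPotential hA j g) := by
  rw [L2.inner_def, L2.inner_def]
  refine integral_congr_ae ?_
  filter_upwards [coeFn_mulPotential hA j f, coeFn_mulPotential hA j g] with x h1 h2
  rw [h1, h2, inner_smul_left, inner_smul_right, Complex.conj_ofReal]

variable [DecidableEq ι] [DecidableEq κ]

/-- The operator `∑ a_j (D_j - A_j) + b`, as an everywhere defined map on `[H¹]^ι`. -/
def firstOrderMap (a : Fin 3 → Matrix ι ι ℂ) (b : Matrix ι ι ℂ) : sobolevH1 ι →ₗ[ℂ] L2 ι :=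
  (firstOrderOperator hA a b).toFun

theorem firstOrderMap_apply (a : Fin 3 → Matrix ι ι ℂ) (b : Matrix ι ι ℂ) (f : sobolevH1 ι) :
    firstOrderMap hA a b f =
      ∑ j, mulMatrix (a j) ((1 / Complex.I) • weakDeriv j f - mulPotential hA j (f : L2 ι))
        + mulMatrix b (f : L2 ι) := by
  simp only [firstOrderMap, firstOrderOperator, momentum, LinearMap.add_apply,
    LinearMap.sum_apply, LinearMap.comp_apply, LinearMap.sub_apply, LinearMap.smul_apply,
    Submodule.subtype_apply]

theorem mem_kerSub_firstOrderOperator {a : Fin 3 → Matrix ι ι ℂ} {b : Matrix ι ι ℂ} {c : ℂ}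
    {f : L2 ι} : f ∈ kerSub (firstOrderOperator hA a b) c ↔
      ∃ g : sobolevH1 ι, firstOrderMap hA a b g = c • (g : L2 ι) ∧ (g : L2 ι) = f := by
  constructor
  · rintro ⟨g, hg, rfl⟩
    exact ⟨g, sub_eq_zero.1 hg, rfl⟩
  · rintro ⟨g, hg, rfl⟩
    exact ⟨g, sub_eq_zero.2 hg, rfl⟩

theorem mulMatrix_eq_compLp (M : Matrix ι ι ℂ) (f : L2 ι) :
    mulMatrix M f = (Matrix.toEuclideanCLM (n := ι) (𝕜 := ℂ) M).compLp f := rfl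

/-- A pair of constant maps `B`, `B'` with `B a_j = a'_j B'` and `B b = β B` intertwines
`∑ a_j (D_j - A_j) + b` with `∑ a'_j (D_j - A_j)`, up to the scalar `β`. -/
theorem compLp_firstOrderMap {a : Fin 3 → Matrix ι ι ℂ} {b : Matrix ι ι ℂ}
    {a' : Fin 3 → Matrix κ κ ℂ} {B B' : Spinor ι →L[ℂ] Spinor κ} {β : ℂ}
    (ha : ∀ j, B ∘L Matrix.toEuclideanCLM (n := ι) (𝕜 := ℂ) (a j)
      = Matrix.toEuclideanCLM (n := κ) (𝕜 := ℂ) (a' j) ∘L B')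
    (hb : B ∘L Matrix.toEuclideanCLM (n := ι) (𝕜 := ℂ) b = β • B) (f : sobolevH1 ι) :
    B.compLp (firstOrderMap hA a b f) =
      firstOrderMap hA a' 0 ⟨B'.compLp f, compLp_mem_sobolevH1 B' f.2⟩
        + β • B.compLp (f : L2 ι) := by
  rw [firstOrderMap_apply, firstOrderMap_apply, compLp_add, compLp_sum]
  congr 1
  · have h0 : mulMatrix (0 : Matrix κ κ ℂ) (B'.compLp (f : L2 ι)) = 0 := by
      simp [mulMatrix_eq_compLp, zero_compLp]
    rw [h0, add_zero]
    refine Finset.sum_congr rfl fun j _ => ?_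
    rw [mulMatrix_eq_compLp, compLp_comp, ha, ← compLp_comp, mulMatrix_eq_compLp, compLp_sub,
      compLp_smul, compLp_weakDeriv, compLp_mulPotential]
  · rw [mulMatrix_eq_compLp, compLp_comp, hb, ContinuousLinearMap.smul_compLp]

theorem inner_mulMatrix {M : Matrix ι ι ℂ} (hM : M.IsHermitian) (f g : L2 ι) :
    inner ℂ (mulMatrix M f) g = inner ℂ f (mulMatrix M g) := by
  have hadj : ∀ u v : Spinor ι, inner ℂ (Matrix.toEuclideanCLM (n := ι) (𝕜 := ℂ) M u) v
      = inner ℂ u (Matrix.toEuclideanCLM (n := ι) (𝕜 := ℂ) M v) := by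
    intro u v
    rw [← ContinuousLinearMap.adjoint_inner_right, ← ContinuousLinearMap.star_eq_adjoint,
      ← map_star, Matrix.star_eq_conjTranspose, hM.eq]
  rw [L2.inner_def, L2.inner_def]
  refine integral_congr_ae ?_
  filter_upwards [(Matrix.toEuclideanCLM (n := ι) (𝕜 := ℂ) M).coeFn_compLp f,
    (Matrix.toEuclideanCLM (n := ι) (𝕜 := ℂ) M).coeFn_compLp g] with x h1 h2
  rw [mulMatrix_eq_compLp, mulMatrix_eq_compLp, h1, h2, hadj]

/-- For Hermitian coefficients `∑ a_j (D_j - A_j)` is symmetric on `H¹`. -/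
theorem inner_firstOrderMap {a : Fin 3 → Matrix ι ι ℂ} (ha : ∀ j, (a j).IsHermitian)
    (f g : sobolevH1 ι) :
    inner ℂ (firstOrderMap hA a 0 f) (g : L2 ι) =
      inner ℂ (f : L2 ι) (firstOrderMap hA a 0 g) := by
  have h0 : ∀ u : L2 ι, mulMatrix (0 : Matrix ι ι ℂ) u = 0 := fun u => by
    simp [mulMatrix_eq_compLp, zero_compLp]
  rw [firstOrderMap_apply, firstOrderMap_apply, h0, h0, add_zero, add_zero,
    sum_inner, inner_sum]
  refine Finset.sum_congr rfl fun j _ => ?_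
  rw [inner_mulMatrix (ha j), map_sub, map_smul, inner_sub_left, inner_sub_right,
    inner_smul_left, inner_smul_right, inner_mulPotential]
  have h := (isWeakDeriv_weakDeriv j f).inner_eq_neg
    ((isWeakDeriv_weakDeriv j g).compLp (Matrix.toEuclideanCLM (n := ι) (𝕜 := ℂ) (a j)))
  simp only [← mulMatrix_eq_compLp] at h
  rw [h, mulMatrix_eq_compLp (a j) (mulPotential hA j (g : L2 ι)), compLp_mulPotential,
    ← mulMatrix_eq_compLp]
  simp

theorem pauli_isHermitian (j : Fin 3) : (pauli j).IsHermitian := by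
  fin_cases j <;> ext i k <;> fin_cases i <;> fin_cases k <;> simp [pauli]

/-- The upper two-spinor of a four-spinor. -/
def upperPart : Spinor (Fin 2 ⊕ Fin 2) →L[ℂ] Spinor (Fin 2) :=
  LinearMap.toContinuousLinearMap
    { toFun := fun v => WithLp.toLp 2 fun i => v (Sum.inl i)
      map_add' := fun _ _ => rfl
      map_smul' := fun _ _ => rfl }

/-- The lower two-spinor of a four-spinor. -/
def lowerPart : Spinor (Fin 2 ⊕ Fin 2) →L[ℂ] Spinor (Fin 2) :=
  LinearMap.toContinuousLinearMap
    { toFun := fun v => WithLp.toLp 2 fun i => v (Sum.inr i)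
      map_add' := fun _ _ => rfl
      map_smul' := fun _ _ => rfl }

theorem upperPart_apply (v : Spinor (Fin 2 ⊕ Fin 2)) (i : Fin 2) :
    upperPart v i = v (Sum.inl i) := rfl

theorem lowerPart_apply (v : Spinor (Fin 2 ⊕ Fin 2)) (i : Fin 2) :
    lowerPart v i = v (Sum.inr i) := rfl

theorem eq_upper_of_lowerPart_eq_zero {v : Spinor (Fin 2 ⊕ Fin 2)} (h : lowerPart v = 0) :
    v = upper (upperPart v) := by
  ext (i | i)
  · rfl
  · exact congrArg (fun w : Spinor (Fin 2) => w i) h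

theorem eq_lower_of_upperPart_eq_zero {v : Spinor (Fin 2 ⊕ Fin 2)} (h : upperPart v = 0) :
    v = lower (lowerPart v) := by
  ext (i | i)
  · exact congrArg (fun w : Spinor (Fin 2) => w i) h
  · rfl

theorem upperPart_comp_diracAlpha (j : Fin 3) :
    upperPart ∘L Matrix.toEuclideanCLM (n := Fin 2 ⊕ Fin 2) (𝕜 := ℂ) (diracAlpha j)
      = Matrix.toEuclideanCLM (n := Fin 2) (𝕜 := ℂ) (pauli j) ∘L lowerPart := by
  ext v i
  simp [upperPart_apply, lowerPart_apply, diracAlpha, Matrix.mulVec, dotProduct]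

theorem lowerPart_comp_diracAlpha (j : Fin 3) :
    lowerPart ∘L Matrix.toEuclideanCLM (n := Fin 2 ⊕ Fin 2) (𝕜 := ℂ) (diracAlpha j)
      = Matrix.toEuclideanCLM (n := Fin 2) (𝕜 := ℂ) (pauli j) ∘L upperPart := by
  ext v i
  simp [upperPart_apply, lowerPart_apply, diracAlpha, Matrix.mulVec, dotProduct]

theorem upperPart_comp_diracBeta (m : ℂ) :
    upperPart ∘L Matrix.toEuclideanCLM (n := Fin 2 ⊕ Fin 2) (𝕜 := ℂ) (m • diracBeta)
      = m • upperPart := by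
  ext v i
  simp [upperPart_apply, diracBeta, Matrix.mulVec, dotProduct, Matrix.one_apply]

theorem lowerPart_comp_diracBeta (m : ℂ) :
    lowerPart ∘L Matrix.toEuclideanCLM (n := Fin 2 ⊕ Fin 2) (𝕜 := ℂ) (m • diracBeta)
      = (-m) • lowerPart := by
  ext v i
  simp [lowerPart_apply, diracBeta, Matrix.mulVec, dotProduct, Matrix.one_apply]

/-- If `T φ = k χ`, the symmetry of `T` gives `conj k ‖χ‖² = ⟨T φ, χ⟩ = ⟨φ, T χ⟩ = 0`. -/
theorem weylDirac_eq_zero_of_apply_eq_smul {φ χ : sobolevH1 (Fin 2)} {k : ℂ} (hk : k ≠ 0)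
    (hχ : firstOrderMap hA pauli 0 χ = 0) (hφ : firstOrderMap hA pauli 0 φ = k • (χ : L2 (Fin 2))) :
    (χ : L2 (Fin 2)) = 0 := by
  have h := inner_firstOrderMap hA pauli_isHermitian φ χ
  rw [hφ, hχ, inner_zero_right, inner_smul_left, mul_eq_zero] at h
  exact inner_self_eq_zero.1 (h.resolve_left (by simpa using hk))

theorem mem_kerSub_weylDirac {φ : sobolevH1 (Fin 2)} (h : firstOrderMap hA pauli 0 φ = 0) :
    (φ : L2 (Fin 2)) ∈ kerSub (weylDirac hA) 0 :=
  (mem_kerSub_firstOrderOperator hA).2 ⟨φ, by rw [h, zero_smul], rfl⟩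

/-- The equation `H f = c f` in terms of the two components of `f = (φ, χ)`. -/
theorem dirac_components {m : ℝ} {c : ℂ} {f : L2 (Fin 2 ⊕ Fin 2)}
    (hf : f ∈ kerSub (dirac m hA) c) : ∃ φ χ : sobolevH1 (Fin 2),
      (φ : L2 (Fin 2)) = upperPart.compLp f ∧ (χ : L2 (Fin 2)) = lowerPart.compLp f ∧
      firstOrderMap hA pauli 0 χ = (c - m) • (φ : L2 (Fin 2)) ∧
      firstOrderMap hA pauli 0 φ = (c + m) • (χ : L2 (Fin 2)) := by
  obtain ⟨g, hg, rfl⟩ := (mem_kerSub_firstOrderOperator hA).1 hf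
  have h1 := compLp_firstOrderMap hA upperPart_comp_diracAlpha (upperPart_comp_diracBeta m) g
  have h2 := compLp_firstOrderMap hA lowerPart_comp_diracAlpha (lowerPart_comp_diracBeta m) g
  rw [hg, compLp_smul] at h1 h2
  refine ⟨⟨_, compLp_mem_sobolevH1 upperPart g.2⟩, ⟨_, compLp_mem_sobolevH1 lowerPart g.2⟩,
    rfl, rfl, ?_, ?_⟩
  · rw [sub_smul]
    exact eq_sub_of_add_eq h1.symm
  · rw [add_smul, ← sub_neg_eq_add, ← neg_smul]
    exact eq_sub_of_add_eq h2.symm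

theorem exists_upper_of_mem_kerSub_dirac {m : ℝ} (hm : 0 < m) {f : L2 (Fin 2 ⊕ Fin 2)}
    (hf : f ∈ kerSub (dirac m hA) (m : ℂ)) :
    ∃ ψ ∈ kerSub (weylDirac hA) 0, ∀ᵐ x, f x = upper (ψ x) := by
  obtain ⟨φ, χ, h1, h2, h3, h4⟩ := dirac_components hA hf
  rw [sub_self, zero_smul] at h3
  have hχ := weylDirac_eq_zero_of_apply_eq_smul hA
    (by rw [← two_mul]; exact_mod_cast (by positivity : 2 * m ≠ 0)) h3 h4
  rw [hχ, smul_zero] at h4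
  refine ⟨φ, mem_kerSub_weylDirac hA h4, ?_⟩
  rw [hχ] at h2
  filter_upwards [lowerPart.coeFn_compLp f, upperPart.coeFn_compLp f,
    Lp.coeFn_zero (Spinor (Fin 2)) 2 (volume : Measure Space)] with x e1 e2 e3
  rw [h1, e2]
  rw [← h2, e3] at e1
  exact eq_upper_of_lowerPart_eq_zero e1.symm

theorem exists_lower_of_mem_kerSub_dirac {m : ℝ} (hm : 0 < m) {f : L2 (Fin 2 ⊕ Fin 2)}
    (hf : f ∈ kerSub (dirac m hA) (-(m : ℂ))) :
    ∃ ψ ∈ kerSub (weylDirac hA) 0, ∀ᵐ x, f x = lower (ψ x) := by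
  obtain ⟨φ, χ, h1, h2, h3, h4⟩ := dirac_components hA hf
  rw [neg_add_cancel, zero_smul] at h4
  have hφ := weylDirac_eq_zero_of_apply_eq_smul hA
    (by rw [← neg_add', neg_ne_zero, ← two_mul]
        exact_mod_cast (by positivity : 2 * m ≠ 0)) h4 h3
  rw [hφ, smul_zero] at h3
  refine ⟨χ, mem_kerSub_weylDirac hA h3, ?_⟩
  rw [hφ] at h1
  filter_upwards [lowerPart.coeFn_compLp f, upperPart.coeFn_compLp f,
    Lp.coeFn_zero (Spinor (Fin 2)) 2 (volume : Measure Space)] with x e1 e2 e3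
  rw [h2, e1]
  rw [← h1, e3] at e2
  exact eq_lower_of_upperPart_eq_zero e2.symm

end Reduction

/-! ### Estimates for the Riesz kernel `|x|⁻²` -/

section Riesz

open Metric

/-- The power `|z|^(-a)` as an extended nonnegative function; its value at `0` is irrelevant. -/
def powKernel (a : ℝ) (z : Space) : ℝ≥0∞ := ENNReal.ofReal (‖z‖ ^ (-a))

/-- The restriction of `|z|^(-a)` to the unit ball. -/
def nearKernel (a : ℝ) : Space → ℝ≥0∞ := (ball (0 : Space) 1).indicator (powKernel a)

/-- The restriction of `|z|^(-a)` to the complement of the unit ball. -/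
def farKernel (a : ℝ) : Space → ℝ≥0∞ := (ball (0 : Space) 1)ᶜ.indicator (powKernel a)

@[fun_prop]
theorem measurable_powKernel (a : ℝ) : Measurable (powKernel a) := by
  unfold powKernel; fun_prop

@[fun_prop]
theorem measurable_nearKernel (a : ℝ) : Measurable (nearKernel a) :=
  (measurable_powKernel a).indicator measurableSet_ball

@[fun_prop]
theorem measurable_farKernel (a : ℝ) : Measurable (farKernel a) :=
  (measurable_powKernel a).indicator measurableSet_ball.compl

theorem nearKernel_add_farKernel (a : ℝ) (z : Space) :
    nearKernel a z + farKernel a z = powKernel a z :=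
  congrFun (Set.indicator_self_add_compl _ _) z

theorem powKernel_add {a b : ℝ} {z : Space} (hz : z ≠ 0) :
    powKernel (a + b) z = powKernel a z * powKernel b z := by
  rw [powKernel, powKernel, powKernel, ← ENNReal.ofReal_mul (by positivity),
    ← Real.rpow_add (norm_pos_iff.2 hz), neg_add]

/-- Away from the exponent `0` no exception has to be made for the origin. -/
theorem powKernel_add_of_pos {a b : ℝ} (ha : 0 < a) (hb : 0 < b) (z : Space) :
    powKernel (a + b) z = powKernel a z * powKernel b z := by
  rcases eq_or_ne z 0 with rfl | hz
  · rw [powKernel, powKernel, norm_zero, Real.zero_rpow (neg_ne_zero.2 ha.ne'),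
      Real.zero_rpow (neg_ne_zero.2 (add_pos ha hb).ne')]
    simp
  · exact powKernel_add hz

theorem nearKernel_add_of_pos {a b : ℝ} (ha : 0 < a) (hb : 0 < b) (z : Space) :
    nearKernel (a + b) z = nearKernel a z * nearKernel b z := by
  by_cases hz : z ∈ ball (0 : Space) 1 <;>
    simp [nearKernel, hz, powKernel_add_of_pos ha hb]

theorem farKernel_add_of_pos {a b : ℝ} (ha : 0 < a) (hb : 0 < b) (z : Space) :
    farKernel (a + b) z = farKernel a z * farKernel b z := by
  by_cases hz : z ∈ (ball (0 : Space) 1)ᶜ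
  · simp only [farKernel, Set.indicator_of_mem hz, powKernel_add_of_pos ha hb]
  · simp only [farKernel, Set.indicator_of_notMem hz, mul_zero]

theorem lintegral_ball_powKernel_ne_top {a : ℝ} (ha : a < 3) {R : ℝ} (hR : 0 < R) :
    ∫⁻ z in ball (0 : Space) R, powKernel a z ≠ ∞ := by
  have h : IntegrableOn (fun z : Space => ‖z‖ ^ (-a)) (ball 0 R) := by
    rw [integrableOn_fun_norm_addHaar volume (f := fun t => t ^ (-a))]
    have h1 : IntegrableOn (fun y : ℝ => y ^ (2 - a)) (Set.Ioo 0 R) :=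
      (intervalIntegral.integrableOn_Ioo_rpow_iff hR).2 (by linarith)
    refine h1.congr_fun (fun y hy => ?_) measurableSet_Ioo
    simp only [finrank_euclideanSpace_fin, smul_eq_mul]
    rw [sub_eq_add_neg, Real.rpow_add hy.1]
    norm_num
  have h2 := h.2
  rw [hasFiniteIntegral_iff_ofReal (Eventually.of_forall fun z => by positivity)] at h2
  exact h2.ne

theorem lintegral_compl_ball_powKernel_ne_top {a : ℝ} (ha : 3 < a) {R : ℝ} (hR : 0 < R) :
    ∫⁻ z in (ball (0 : Space) R)ᶜ, powKernel a z ≠ ∞ := by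
  have h : ∀ z ∈ (ball (0 : Space) R)ᶜ, powKernel a z ≤
      ENNReal.ofReal (((1 + R) / R) ^ a) * ENNReal.ofReal ((1 + ‖z‖) ^ (-a)) := by
    intro z hz
    have hz' : R ≤ ‖z‖ := by simpa using hz
    have hz0 : 0 < ‖z‖ := hR.trans_le hz'
    rw [powKernel, ← ENNReal.ofReal_mul (by positivity)]
    refine ENNReal.ofReal_le_ofReal ?_
    rw [Real.rpow_neg hz0.le, Real.rpow_neg (by positivity), inv_eq_one_div, ← div_eq_mul_inv,
      div_le_div_iff₀ (by positivity) (by positivity), one_mul,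
      ← Real.mul_rpow (by positivity) hz0.le]
    refine Real.rpow_le_rpow (by positivity) ?_ (by linarith)
    rw [div_mul_eq_mul_div, le_div_iff₀ hR]
    nlinarith
  refine ((setLIntegral_mono' measurableSet_ball.compl h).trans_lt ?_).ne
  refine (setLIntegral_le_lintegral _ _).trans_lt ?_
  rw [lintegral_const_mul _ (by fun_prop)]
  exact ENNReal.mul_lt_top ENNReal.ofReal_lt_top (finite_integral_one_add_norm (by simpa using ha))

theorem lintegral_nearKernel_ne_top {a : ℝ} (ha : a < 3) : ∫⁻ z, nearKernel a z ≠ ∞ := by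
  unfold nearKernel
  rw [lintegral_indicator measurableSet_ball]
  exact lintegral_ball_powKernel_ne_top ha one_pos

theorem lintegral_farKernel_ne_top {a : ℝ} (ha : 3 < a) : ∫⁻ z, farKernel a z ≠ ∞ := by
  unfold farKernel
  rw [lintegral_indicator measurableSet_ball.compl]
  exact lintegral_compl_ball_powKernel_ne_top ha one_pos

theorem powKernel_le_of_le {a : ℝ} (ha : 0 ≤ a) {c : ℝ} (hc : 0 < c) {z : Space} (hz : c ≤ ‖z‖) :
    powKernel a z ≤ ENNReal.ofReal (c ^ (-a)) :=
  ENNReal.ofReal_le_ofReal (Real.rpow_le_rpow_of_nonpos hc hz (by linarith))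

theorem powKernel_smul (a : ℝ) {r : ℝ} (hr : 0 < r) (z : Space) :
    powKernel a (r • z) = ENNReal.ofReal (r ^ (-a)) * powKernel a z := by
  rw [powKernel, powKernel, norm_smul, Real.norm_of_nonneg hr.le,
    Real.mul_rpow hr.le (norm_nonneg _), ENNReal.ofReal_mul (by positivity)]

theorem lintegral_comp_smul_space (f : Space → ℝ≥0∞) {r : ℝ} (hr : 0 < r) :
    ∫⁻ y, f y = ENNReal.ofReal (r ^ 3) * ∫⁻ z, f (r • z) := by
  have h1 : ∫⁻ z, f (r • z) = ∫⁻ y, f y ∂(Measure.map (r • ·) (volume : Measure Space)) :=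
    ((Homeomorph.smulOfNeZero r hr.ne').toMeasurableEquiv.measurableEmbedding.lintegral_map f).symm
  rw [h1, Measure.map_addHaar_smul _ hr.ne', lintegral_smul_measure, smul_eq_mul, ← mul_assoc,
    ← ENNReal.ofReal_mul (by positivity)]
  simp [abs_of_pos hr, hr.ne']

/-- The Riesz potential of a homogeneous function: `|x|⁻² * |x|^(-b) = c |x|^(1-b)`. -/
theorem exists_lintegral_powKernel_le {b : ℝ} (hb : 1 < b) (hb' : b < 3) :
    ∃ C : ℝ≥0∞, C ≠ ∞ ∧ ∀ x : Space, x ≠ 0 →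
      ∫⁻ y, powKernel 2 (x - y) * powKernel b y ≤ C * powKernel (b - 1) x := by
  set B : Set Space := ball 0 (1 / 2) with hB
  set c1 : ℝ≥0∞ := ENNReal.ofReal ((1 / 2 : ℝ) ^ (-2 : ℝ))
  set c2 : ℝ≥0∞ := ENNReal.ofReal ((1 / 2 : ℝ) ^ (-b))
  set c3 : ℝ≥0∞ := ENNReal.ofReal ((1 / 3 : ℝ) ^ (-2 : ℝ))
  have hmB : MeasurableSet B := measurableSet_ball
  refine ⟨c1 * (∫⁻ z in B, powKernel b z) + c2 * (∫⁻ z in B, powKernel 2 z)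
    + c3 * ∫⁻ z in Bᶜ, powKernel (2 + b) z, ?_, ?_⟩
  · have h1 := lintegral_ball_powKernel_ne_top hb' (R := 1 / 2) (by norm_num)
    have h2 := lintegral_ball_powKernel_ne_top (a := 2) (by norm_num) (R := 1 / 2) (by norm_num)
    have h3 := lintegral_compl_ball_powKernel_ne_top (a := 2 + b) (by linarith) (R := 1 / 2)
      (by norm_num)
    exact ENNReal.add_ne_top.2 ⟨ENNReal.add_ne_top.2
      ⟨ENNReal.mul_ne_top ENNReal.ofReal_ne_top h1, ENNReal.mul_ne_top ENNReal.ofReal_ne_top h2⟩,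
      ENNReal.mul_ne_top ENNReal.ofReal_ne_top h3⟩
  -- on the unit sphere, split according to which of `y`, `e - y` is small
  have hunit : ∀ e : Space, ‖e‖ = 1 → ∫⁻ y, powKernel 2 (e - y) * powKernel b y ≤
      c1 * (∫⁻ z in B, powKernel b z) + c2 * (∫⁻ z in B, powKernel 2 z)
        + c3 * ∫⁻ z in Bᶜ, powKernel (2 + b) z := by
    intro e he
    have hpt : ∀ y, powKernel 2 (e - y) * powKernel b y ≤
        c1 * B.indicator (powKernel b) y + c2 * B.indicator (powKernel 2) (e - y)
          + c3 * Bᶜ.indicator (powKernel (2 + b)) y := by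
      intro y
      by_cases h1 : y ∈ B
      · have hy : ‖y‖ < 1 / 2 := by simpa [hB] using h1
        have : 1 / 2 ≤ ‖e - y‖ := by
          have := norm_sub_norm_le e y; linarith
        rw [Set.indicator_of_mem h1, add_assoc]
        exact (mul_le_mul_left (powKernel_le_of_le (by norm_num) (by norm_num) this) _).trans
          le_self_add
      · have hy : 1 / 2 ≤ ‖y‖ := by simpa [hB] using h1
        by_cases h2 : e - y ∈ B
        · rw [Set.indicator_of_mem h2, mul_comm (powKernel 2 _)]
          exact (mul_le_mul_left (powKernel_le_of_le (by linarith) (by norm_num) hy) _).trans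
            (le_add_self.trans le_self_add)
        · have hey : 1 / 2 ≤ ‖e - y‖ := by simpa [hB] using h2
          have hy0 : y ≠ 0 := norm_pos_iff.1 (by linarith)
          have h3 : ‖y‖ ≤ 3 * ‖e - y‖ := by
            have := norm_sub_norm_le y e
            rw [norm_sub_rev] at this; linarith
          have h4 : powKernel 2 (e - y) ≤ c3 * powKernel 2 y := by
            rw [powKernel, powKernel, ← ENNReal.ofReal_mul (by positivity),
              ← Real.mul_rpow (by norm_num) (norm_nonneg _)]
            exact ENNReal.ofReal_le_ofReal
              (Real.rpow_le_rpow_of_nonpos (by positivity) (by linarith) (by norm_num))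
          rw [Set.indicator_of_mem (show y ∈ Bᶜ from h1), powKernel_add hy0, ← mul_assoc]
          exact (mul_le_mul_left h4 _).trans le_add_self
    refine (lintegral_mono hpt).trans ?_
    have m1 : Measurable fun y => c1 * B.indicator (powKernel b) y :=
      ((measurable_powKernel b).indicator hmB).const_mul _
    have m2' : Measurable fun y => B.indicator (powKernel 2) (e - y) :=
      ((measurable_powKernel 2).indicator hmB).comp (measurable_const.sub measurable_id)
    have m2 : Measurable fun y => c2 * B.indicator (powKernel 2) (e - y) := m2'.const_mul _
    have m12 : Measurable fun y =>
      c1 * B.indicator (powKernel b) y + c2 * B.indicator (powKernel 2) (e - y) := m1.add m2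
    rw [lintegral_add_left m12, lintegral_add_left m1,
      lintegral_const_mul _ ((measurable_powKernel b).indicator hmB),
      lintegral_const_mul _ m2',
      lintegral_const_mul _ ((measurable_powKernel (2 + b)).indicator hmB.compl),
      lintegral_sub_left_eq_self (B.indicator (powKernel 2)) e,
      lintegral_indicator hmB, lintegral_indicator hmB, lintegral_indicator hmB.compl]
  -- both sides are homogeneous in `x`, so that the general case follows by scaling
  intro x hx
  have hr : 0 < ‖x‖ := norm_pos_iff.2 hx
  set e : Space := ‖x‖⁻¹ • x with he_def
  have he : ‖e‖ = 1 := by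
    rw [he_def, norm_smul, norm_inv, norm_norm, inv_mul_cancel₀ hr.ne']
  have hxe : x = ‖x‖ • e := by rw [he_def, smul_smul, mul_inv_cancel₀ hr.ne', one_smul]
  rw [lintegral_comp_smul_space _ hr]
  have : ∀ z, powKernel 2 (x - ‖x‖ • z) * powKernel b (‖x‖ • z) =
      ENNReal.ofReal (‖x‖ ^ (-2 - b)) * (powKernel 2 (e - z) * powKernel b z) := by
    intro z
    have h1 : x - ‖x‖ • z = ‖x‖ • (e - z) := by rw [smul_sub, ← hxe]
    rw [h1, powKernel_smul _ hr, powKernel_smul _ hr, sub_eq_add_neg (-2 : ℝ),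
      Real.rpow_add hr, ENNReal.ofReal_mul (by positivity)]
    ring
  simp_rw [this]
  rw [lintegral_const_mul _ (by fun_prop), ← mul_assoc, ← ENNReal.ofReal_mul (by positivity),
    mul_comm]
  refine mul_le_mul' (hunit e he) (le_of_eq ?_)
  rw [powKernel, ← Real.rpow_natCast, ← Real.rpow_add hr]
  congr 2
  push_cast
  ring

theorem mul_le_sq_add_sq (a b : ℝ≥0∞) : a * b ≤ a ^ 2 + b ^ 2 := by
  rcases le_total a b with h | h
  · exact (mul_le_mul_left h b).trans (by rw [← sq]; exact le_add_self)
  · exact (mul_le_mul_right h a).trans (by rw [← sq]; exact le_self_add)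

/-- The part of the Riesz potential away from the diagonal is bounded, uniformly in `x`, for
`u ∈ L²`, because `|z|⁻⁴` is integrable at infinity. -/
theorem lintegral_farKernel_mul_le (u : Space → ℝ≥0∞) (x : Space) :
    ∫⁻ y, farKernel 2 (x - y) * u y ≤ (∫⁻ z, farKernel 4 z) + ∫⁻ y, u y ^ 2 := by
  calc ∫⁻ y, farKernel 2 (x - y) * u y ≤ ∫⁻ y, (farKernel 4 (x - y) + u y ^ 2) := by
        refine lintegral_mono fun y => (mul_le_sq_add_sq _ _).trans (le_of_eq ?_)
        rw [sq, ← farKernel_add_of_pos two_pos two_pos]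
        norm_num
    _ = _ := by
        rw [lintegral_add_left (by fun_prop), lintegral_sub_left_eq_self (farKernel 4) x]

/-- The iterated near part of the Riesz potential is bounded for `u ∈ L²`. The factorisation
`|z|⁻² = |z|^(-1.4) |z|^(-0.6)` leaves, after the inequality `ab ≤ a² + b²`, only the powers
`2.8` and, once that inequality is used again for the product of two powers `1.2`, `2.4`; both are
below the dimension `3`. -/
theorem lintegral_nearKernel_nearKernel_le {u : Space → ℝ≥0∞} (hu : Measurable u) (x : Space) :
    ∫⁻ y, nearKernel 2 (x - y) * ∫⁻ z, nearKernel 2 (y - z) * u z ≤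
      (∫⁻ z, nearKernel 2.8 z) * (∫⁻ z, nearKernel 2.8 z)
        + (∫⁻ z, u z ^ 2) * (2 * ∫⁻ z, nearKernel 2.4 z) := by
  have e1 : ∀ z, nearKernel 2 z = nearKernel 1.4 z * nearKernel 0.6 z := fun z => by
    rw [← nearKernel_add_of_pos (by norm_num) (by norm_num)]; norm_num
  have e2 : ∀ z, nearKernel 2.8 z = nearKernel 1.4 z ^ 2 := fun z => by
    rw [sq, ← nearKernel_add_of_pos (by norm_num) (by norm_num)]; norm_num
  have e3 : ∀ z, nearKernel 1.2 z = nearKernel 0.6 z ^ 2 := fun z => by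
    rw [sq, ← nearKernel_add_of_pos (by norm_num) (by norm_num)]; norm_num
  have e4 : ∀ z, nearKernel 2.4 z = nearKernel 1.2 z ^ 2 := fun z => by
    rw [sq, ← nearKernel_add_of_pos (by norm_num) (by norm_num)]; norm_num
  have hpt : ∀ y z, nearKernel 2 (x - y) * (nearKernel 2 (y - z) * u z) ≤
      nearKernel 2.8 (x - y) * nearKernel 2.8 (y - z)
        + nearKernel 1.2 (x - y) * nearKernel 1.2 (y - z) * u z ^ 2 := by
    intro y z
    calc _ = (nearKernel 1.4 (x - y) * nearKernel 1.4 (y - z)) *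
          (nearKernel 0.6 (x - y) * nearKernel 0.6 (y - z) * u z) := by
          rw [e1, e1]; ring
      _ ≤ _ := (mul_le_sq_add_sq _ _).trans (le_of_eq (by simp only [e2, e3]; ring))
  calc ∫⁻ y, nearKernel 2 (x - y) * ∫⁻ z, nearKernel 2 (y - z) * u z
      = ∫⁻ y, ∫⁻ z, nearKernel 2 (x - y) * (nearKernel 2 (y - z) * u z) := by
        refine lintegral_congr fun y => ?_
        rw [lintegral_const_mul _ (by fun_prop)]
    _ ≤ ∫⁻ y, ∫⁻ z, (nearKernel 2.8 (x - y) * nearKernel 2.8 (y - z)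
          + nearKernel 1.2 (x - y) * nearKernel 1.2 (y - z) * u z ^ 2) :=
        lintegral_mono fun y => lintegral_mono fun z => hpt y z
    _ = (∫⁻ y, ∫⁻ z, nearKernel 2.8 (x - y) * nearKernel 2.8 (y - z))
          + ∫⁻ y, ∫⁻ z, nearKernel 1.2 (x - y) * nearKernel 1.2 (y - z) * u z ^ 2 := by
        rw [← lintegral_add_left]
        · refine lintegral_congr fun y => ?_
          rw [lintegral_add_left (by fun_prop)]
        · exact Measurable.lintegral_prod_right' (f := fun p : Space × Space =>
            nearKernel 2.8 (x - p.1) * nearKernel 2.8 (p.1 - p.2)) (by fun_prop)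
    _ ≤ _ := by
        refine add_le_add (le_of_eq ?_) ?_
        · rw [← lintegral_sub_left_eq_self (nearKernel 2.8) x,
            ← lintegral_mul_const _ (by fun_prop)]
          refine lintegral_congr fun y => ?_
          rw [lintegral_const_mul _ (by fun_prop), lintegral_sub_left_eq_self (nearKernel 2.8) y,
            lintegral_sub_left_eq_self (nearKernel 2.8) x]
        · rw [lintegral_lintegral_swap (by fun_prop), ← lintegral_mul_const _ (by fun_prop)]
          refine lintegral_mono fun z => ?_
          rw [lintegral_mul_const _ (by fun_prop), mul_comm]
          refine mul_le_mul_right ?_ _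
          calc ∫⁻ y, nearKernel 1.2 (x - y) * nearKernel 1.2 (y - z)
              ≤ ∫⁻ y, (nearKernel 2.4 (x - y) + nearKernel 2.4 (y - z)) :=
                lintegral_mono fun y => (mul_le_sq_add_sq _ _).trans
                  (le_of_eq (by simp only [e4]))
            _ = 2 * ∫⁻ z, nearKernel 2.4 z := by
                rw [lintegral_add_left (by fun_prop), lintegral_sub_left_eq_self (nearKernel 2.4) x,
                  lintegral_sub_right_eq_self (nearKernel 2.4) z, two_mul]

/-- A square integrable function dominated by a multiple of its own Riesz potential is essentially
bounded: two iterations suffice, since the Riesz kernel is locally integrable with iterated kernel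
locally in `L²`, and square integrable at infinity. -/
theorem exists_ae_le_of_le_riesz {u : Space → ℝ≥0∞} (hu : Measurable u)
    (hu2 : ∫⁻ y, u y ^ 2 ≠ ∞) {M : ℝ≥0∞} (hM : M ≠ ∞)
    (h : ∀ᵐ x, u x ≤ M * ∫⁻ y, powKernel 2 (x - y) * u y) :
    ∃ B : ℝ≥0∞, B ≠ ∞ ∧ ∀ᵐ x, u x ≤ B := by
  set N := (∫⁻ z, farKernel 4 z) + ∫⁻ y, u y ^ 2 with hN
  have hN' : N ≠ ∞ := ENNReal.add_ne_top.2 ⟨lintegral_farKernel_ne_top (by norm_num), hu2⟩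
  -- up to a constant only the near part of the kernel matters
  have h1 : ∀ᵐ x, u x ≤ M * (∫⁻ y, nearKernel 2 (x - y) * u y) + M * N := by
    filter_upwards [h] with x hx
    refine hx.trans ?_
    rw [← mul_add]
    refine mul_le_mul_right ?_ _
    simp_rw [← nearKernel_add_farKernel, add_mul]
    rw [lintegral_add_left (by fun_prop)]
    gcongr
    exact lintegral_farKernel_mul_le u x
  set K := (∫⁻ z, nearKernel 2.8 z) * (∫⁻ z, nearKernel 2.8 z)
        + (∫⁻ z, u z ^ 2) * (2 * ∫⁻ z, nearKernel 2.4 z) with hK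
  have hK' : K ≠ ∞ := by
    have i1 := lintegral_nearKernel_ne_top (a := 2.8) (by norm_num)
    have i2 := lintegral_nearKernel_ne_top (a := 2.4) (by norm_num)
    exact ENNReal.add_ne_top.2 ⟨ENNReal.mul_ne_top i1 i1,
      ENNReal.mul_ne_top hu2 (ENNReal.mul_ne_top (by norm_num) i2)⟩
  -- inserting the bound `h1` into its own right-hand side yields the iterated near kernel
  have h2 : ∀ x, ∫⁻ y, nearKernel 2 (x - y) * u y ≤
      M * K + M * N * ∫⁻ z, nearKernel 2 z := by
    intro x
    have hm : Measurable fun y => ∫⁻ z, nearKernel 2 (y - z) * u z :=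
      Measurable.lintegral_prod_right' (f := fun p : Space × Space =>
        nearKernel 2 (p.1 - p.2) * u p.2) (by fun_prop)
    calc ∫⁻ y, nearKernel 2 (x - y) * u y
        ≤ ∫⁻ y, (M * (nearKernel 2 (x - y) * ∫⁻ z, nearKernel 2 (y - z) * u z)
            + M * N * nearKernel 2 (x - y)) := by
          refine lintegral_mono_ae ?_
          filter_upwards [h1] with y hy
          exact (mul_le_mul_right hy _).trans (le_of_eq (by ring))
      _ = M * (∫⁻ y, nearKernel 2 (x - y) * ∫⁻ z, nearKernel 2 (y - z) * u z)
            + M * N * ∫⁻ z, nearKernel 2 z := by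
          rw [lintegral_add_left (by fun_prop), lintegral_const_mul _ (by fun_prop),
            lintegral_const_mul _ (by fun_prop), lintegral_sub_left_eq_self (nearKernel 2) x]
      _ ≤ _ := by
          gcongr
          exact lintegral_nearKernel_nearKernel_le hu x
  refine ⟨M * (M * K + M * N * ∫⁻ z, nearKernel 2 z) + M * N, ?_, ?_⟩
  · have i1 := lintegral_nearKernel_ne_top (a := 2) (by norm_num)
    finiteness
  · filter_upwards [h1] with x hx
    refine hx.trans ?_
    gcongr
    exact h2 x

theorem ae_ne_zero : ∀ᵐ x : Space, x ≠ 0 := by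
  simp [ae_iff]

/-- Each application of the Riesz potential to `⟨y⟩^(-1-δ) u` improves the decay of `u` by the
factor `|x|^(-δ)`, as long as the decay rate stays below `2`. -/
theorem exists_ae_le_powKernel_of_le_riesz {u w : Space → ℝ≥0∞} {δ : ℝ} (hδ : 0 < δ)
    {M B : ℝ≥0∞} (hM : M ≠ ∞) (hB : B ≠ ∞) (hw : ∀ᵐ y, w y ≤ powKernel (1 + δ) y)
    (huB : ∀ᵐ x, u x ≤ B) (h : ∀ᵐ x, u x ≤ M * ∫⁻ y, powKernel 2 (x - y) * (w y * u y))
    (n : ℕ) (hn : n * δ < 2) :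
    ∃ C : ℝ≥0∞, C ≠ ∞ ∧ ∀ᵐ x, u x ≤ C * powKernel (n * δ) x := by
  induction n with
  | zero =>
    refine ⟨B, hB, ?_⟩
    filter_upwards [huB] with x hx
    simpa [powKernel] using hx
  | succ n ih =>
    push_cast at hn
    obtain ⟨C, hC, hCu⟩ := ih (by linarith)
    obtain ⟨D, hD, hDr⟩ := exists_lintegral_powKernel_le (b := 1 + (n + 1) * δ)
      (by nlinarith [Nat.cast_nonneg (α := ℝ) n]) (by linarith)
    refine ⟨M * (C * D), by finiteness, ?_⟩
    filter_upwards [h, ae_ne_zero] with x hx hx0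
    refine hx.trans ?_
    rw [mul_assoc]
    refine mul_le_mul_right ?_ _
    calc ∫⁻ y, powKernel 2 (x - y) * (w y * u y)
        ≤ ∫⁻ y, C * (powKernel 2 (x - y) * powKernel (1 + (n + 1) * δ) y) := by
          refine lintegral_mono_ae ?_
          filter_upwards [hw, hCu, ae_ne_zero] with y h1 h2 h3
          have : (1 + ((n : ℝ) + 1) * δ) = (1 + δ) + n * δ := by ring
          rw [this, powKernel_add h3]
          refine (mul_le_mul_right (mul_le_mul' h1 h2) _).trans (le_of_eq ?_)
          ring
      _ = C * ∫⁻ y, powKernel 2 (x - y) * powKernel (1 + (n + 1) * δ) y :=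
          lintegral_const_mul _ (by fun_prop)
      _ ≤ C * D * powKernel (((n + 1 : ℕ) : ℝ) * δ) x := by
          rw [mul_assoc]
          refine mul_le_mul_right ((hDr x hx0).trans (le_of_eq ?_)) _
          congr 2
          push_cast
          ring

end Riesz

/-! ### The potential `∫ |x - y|⁻³ S(x - y) h(y) dy` of a decaying density -/

section Potential

open Metric Topology

variable {V : Type*} [NormedAddCommGroup V] {h : Space → V}

theorem powKernel_two (z : Space) : powKernel 2 z = ENNReal.ofReal ((‖z‖ ^ 2)⁻¹) := by
  rw [powKernel, Real.rpow_neg (norm_nonneg _)]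
  norm_num

theorem enorm_le_of_norm_le {a b : ℝ} {v w : V} (ha : 0 ≤ a) (hb : 0 ≤ b)
    (h : ‖v‖ ≤ a * b * ‖w‖) :
    ‖v‖ₑ ≤ ENNReal.ofReal a * (ENNReal.ofReal b * ‖w‖ₑ) := by
  rw [← ofReal_norm v, ← ofReal_norm w, ← ENNReal.ofReal_mul hb, ← ENNReal.ofReal_mul ha]
  exact ENNReal.ofReal_le_ofReal (by rwa [← mul_assoc])

theorem integrable_of_enorm_le {a : ℝ} (ha : 3 < a) {C : ℝ≥0∞} (hC : C ≠ ∞)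
    (hm : AEStronglyMeasurable h volume) (hb : ∀ᵐ y, ‖h y‖ₑ ≤ C)
    (hd : ∀ᵐ y, ‖h y‖ₑ ≤ C * powKernel a y) : Integrable h := by
  refine ⟨hm, ?_⟩
  rw [hasFiniteIntegral_iff_enorm,
    ← lintegral_add_compl _ (measurableSet_ball (x := (0 : Space)) (ε := 1))]
  refine ENNReal.add_lt_top.2 ⟨?_, ?_⟩
  · refine (lintegral_mono_ae (ae_restrict_of_ae hb)).trans_lt ?_
    rw [setLIntegral_const]
    exact ENNReal.mul_lt_top hC.lt_top measure_ball_lt_top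
  · refine (lintegral_mono_ae (ae_restrict_of_ae hd)).trans_lt ?_
    rw [lintegral_const_mul _ (by fun_prop)]
    exact ENNReal.mul_lt_top hC.lt_top (lintegral_compl_ball_powKernel_ne_top ha one_pos).lt_top

theorem lintegral_powKernel_two_mul_ne_top {C : ℝ≥0∞} (hC : C ≠ ∞) (hi : Integrable h)
    (hb : ∀ᵐ y, ‖h y‖ₑ ≤ C) (x : Space) : ∫⁻ y, powKernel 2 (x - y) * ‖h y‖ₑ ≠ ∞ := by
  have h1 : ∫⁻ y, powKernel 2 (x - y) * ‖h y‖ₑ ≤ ∫⁻ y, (nearKernel 2 (x - y) * C + ‖h y‖ₑ) := by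
    refine lintegral_mono_ae ?_
    filter_upwards [hb] with y hy
    rw [← nearKernel_add_farKernel, add_mul]
    refine add_le_add (mul_le_mul_right hy _) (mul_le_of_le_one_left zero_le ?_)
    by_cases hz : x - y ∈ (ball (0 : Space) 1)ᶜ
    · rw [farKernel, Set.indicator_of_mem hz]
      refine (powKernel_le_of_le two_pos.le one_pos (by simpa using hz)).trans (by simp)
    · rw [farKernel, Set.indicator_of_notMem hz]; exact zero_le
  refine ne_top_of_le_ne_top ?_ h1
  rw [lintegral_add_left (by fun_prop), lintegral_mul_const _ (by fun_prop),
    lintegral_sub_left_eq_self (nearKernel 2) x]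
  exact ENNReal.add_ne_top.2 ⟨ENNReal.mul_ne_top (lintegral_nearKernel_ne_top (by norm_num)) hC,
    (hasFiniteIntegral_iff_enorm.1 hi.2).ne⟩

variable [NormedSpace ℝ V]

/-- The integrand `|z|⁻³ S(z) v` of the vector-valued Riesz potential. -/
def kernelMap (S : Space →L[ℝ] V →L[ℝ] V) (z : Space) (v : V) : V := (‖z‖ ^ 3)⁻¹ • S z v

/-- The potential `x ↦ ∫ |x - y|⁻³ S(x - y) h(y) dy`. -/
def potential (S : Space →L[ℝ] V →L[ℝ] V) (h : Space → V) (x : Space) : V :=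
  ∫ y, kernelMap S (x - y) (h y)

theorem norm_smul_apply_le {c b : ℝ} (hc : 0 ≤ c) (S : Space →L[ℝ] V →L[ℝ] V) (z : Space) (v : V)
    (hb : c * ‖z‖ ≤ b) : ‖c • S z v‖ ≤ ‖S‖ * b * ‖v‖ := by
  rw [norm_smul, Real.norm_of_nonneg hc]
  calc c * ‖S z v‖ ≤ c * (‖S‖ * ‖z‖ * ‖v‖) :=
        mul_le_mul_of_nonneg_left (S.le_opNorm₂ z v) hc
    _ = ‖S‖ * (c * ‖z‖) * ‖v‖ := by ring
    _ ≤ _ := by gcongr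

theorem inv_norm_cube_mul_norm (z : Space) : (‖z‖ ^ 3)⁻¹ * ‖z‖ = (‖z‖ ^ 2)⁻¹ := by
  rcases eq_or_ne ‖z‖ 0 with hz | hz
  · simp [hz]
  · field_simp

theorem norm_kernelMap_le (S : Space →L[ℝ] V →L[ℝ] V) (z : Space) (v : V) :
    ‖kernelMap S z v‖ ≤ ‖S‖ * (‖z‖ ^ 2)⁻¹ * ‖v‖ :=
  norm_smul_apply_le (by positivity) S z v (inv_norm_cube_mul_norm z).le

theorem enorm_kernelMap_le (S : Space →L[ℝ] V →L[ℝ] V) (z : Space) (v : V) :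
    ‖kernelMap S z v‖ₑ ≤ ENNReal.ofReal ‖S‖ * (powKernel 2 z * ‖v‖ₑ) := by
  rw [powKernel_two]
  exact enorm_le_of_norm_le S.opNorm_nonneg (by positivity) (norm_kernelMap_le S z v)

theorem aestronglyMeasurable_smul_apply (S : Space →L[ℝ] V →L[ℝ] V)
    (hm : AEStronglyMeasurable h volume) {c : Space → ℝ} (hc : Measurable c) (x : Space) :
    AEStronglyMeasurable (fun y => c (x - y) • S (x - y) (h y)) volume := by
  refine AEStronglyMeasurable.smul
    (hc.comp (measurable_const.sub measurable_id)).aestronglyMeasurable ?_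
  exact S.aestronglyMeasurable_comp₂
    (measurable_const.sub measurable_id).aestronglyMeasurable hm

theorem aestronglyMeasurable_kernelMap (S : Space →L[ℝ] V →L[ℝ] V)
    (hm : AEStronglyMeasurable h volume) (x : Space) :
    AEStronglyMeasurable (fun y => kernelMap S (x - y) (h y)) volume :=
  aestronglyMeasurable_smul_apply S hm (c := fun z => (‖z‖ ^ 3)⁻¹) (by fun_prop) x

theorem integrable_kernelMap (S : Space →L[ℝ] V →L[ℝ] V) (hm : AEStronglyMeasurable h volume)
    {x : Space} (hx : ∫⁻ y, powKernel 2 (x - y) * ‖h y‖ₑ ≠ ∞) :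
    Integrable fun y => kernelMap S (x - y) (h y) := by
  refine ⟨aestronglyMeasurable_kernelMap S hm x, ?_⟩
  rw [hasFiniteIntegral_iff_enorm]
  refine (lintegral_mono fun y => enorm_kernelMap_le S (x - y) (h y)).trans_lt ?_
  rw [lintegral_const_mul' _ _ ENNReal.ofReal_ne_top]
  exact ENNReal.mul_lt_top ENNReal.ofReal_lt_top hx.lt_top

/-- The potential of a bounded integrable density is the uniform limit of the potentials with
kernel truncated at distance `ε` from the diagonal, hence continuous. -/
theorem continuous_potential (S : Space →L[ℝ] V →L[ℝ] V) {C : ℝ≥0∞} (hC : C ≠ ∞)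
    (hi : Integrable h) (hb : ∀ᵐ y, ‖h y‖ₑ ≤ C) : Continuous (potential S h) := by
  set ε : ℕ → ℝ := fun n => 1 / ((n : ℝ) + 1) with hε
  have hεpos : ∀ n, 0 < ε n := fun n => by positivity
  set P : ℕ → Space → V := fun n x => ∫ y, (max ‖x - y‖ (ε n) ^ 3)⁻¹ • S (x - y) (h y) with hP
  have hbound : ∀ n z (v : V), ‖(max ‖z‖ (ε n) ^ 3)⁻¹ • S z v‖ ≤ ‖S‖ * (ε n ^ 2)⁻¹ * ‖v‖ := by
    intro n z v
    have hmax : 0 < max ‖z‖ (ε n) := lt_max_of_lt_right (hεpos n)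
    refine norm_smul_apply_le (by positivity) S z v ?_
    calc (max ‖z‖ (ε n) ^ 3)⁻¹ * ‖z‖ ≤ (max ‖z‖ (ε n) ^ 3)⁻¹ * max ‖z‖ (ε n) := by
          gcongr; exact le_max_left _ _
      _ = (max ‖z‖ (ε n) ^ 2)⁻¹ := by field_simp
      _ ≤ _ := by
          have := hεpos n
          gcongr; exact le_max_right _ _
  have hmeas : ∀ n x, AEStronglyMeasurable
      (fun y => (max ‖x - y‖ (ε n) ^ 3)⁻¹ • S (x - y) (h y)) volume := fun n x =>
    aestronglyMeasurable_smul_apply S hi.1 (c := fun z => (max ‖z‖ (ε n) ^ 3)⁻¹) (by fun_prop) x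
  have hcont : ∀ n, Continuous (P n) := by
    intro n
    refine continuous_of_dominated (bound := fun y => ‖S‖ * (ε n ^ 2)⁻¹ * ‖h y‖) (hmeas n)
      (fun x => Eventually.of_forall fun y => hbound n _ _) (hi.norm.const_mul _)
      (Eventually.of_forall fun y => ?_)
    have : ∀ x : Space, max ‖x - y‖ (ε n) ^ 3 ≠ 0 := fun x =>
      (pow_pos (lt_max_of_lt_right (hεpos n)) 3).ne'
    have h1 : Continuous fun x : Space => S (x - y) (h y) :=
      (S.flip (h y)).continuous.comp (continuous_id.sub continuous_const)
    exact Continuous.smul (Continuous.inv₀ (by fun_prop) this) h1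
  -- the truncation changes the potential at most by the mass of `|z|⁻²` on the `ε`-ball
  have hball : Tendsto (fun n => ENNReal.ofReal ‖S‖ *
      (C * ∫⁻ z in ball (0 : Space) (ε n), powKernel 2 z)) atTop (𝓝 0) := by
    have hvol : Tendsto (fun n => volume.restrict (ball (0 : Space) 1) (ball (0 : Space) (ε n)))
        atTop (𝓝 0) := by
      have h0 : Tendsto (fun n => volume (ball (0 : Space) (ε n))) atTop (𝓝 0) := by
        simp_rw [EuclideanSpace.volume_ball_fin_three]
        have : Tendsto ε atTop (𝓝 0) := tendsto_one_div_add_atTop_nhds_zero_nat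
        have h2 : Tendsto (fun n => ENNReal.ofReal (ε n) ^ 3 * ENNReal.ofReal (Real.pi * 4 / 3))
            atTop (𝓝 (ENNReal.ofReal 0 ^ 3 * ENNReal.ofReal (Real.pi * 4 / 3))) :=
          ENNReal.Tendsto.mul_const (((ENNReal.continuous_pow 3).tendsto _).comp
            (ENNReal.tendsto_ofReal this)) (Or.inr ENNReal.ofReal_ne_top)
        simpa using h2
      exact tendsto_of_tendsto_of_tendsto_of_le_of_le tendsto_const_nhds h0
        (fun _ => zero_le) fun n => Measure.restrict_apply_le _ _
    have h1 := tendsto_setLIntegral_zero (μ := volume.restrict (ball (0 : Space) 1))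
      (f := powKernel 2) (lintegral_ball_powKernel_ne_top (by norm_num) one_pos) hvol
    have h2 : ∀ n, ∫⁻ z in ball (0 : Space) (ε n), powKernel 2 z ∂(volume.restrict (ball 0 1)) =
        ∫⁻ z in ball (0 : Space) (ε n), powKernel 2 z := fun n => by
      rw [Measure.restrict_restrict measurableSet_ball, Set.inter_eq_left.2]
      refine ball_subset_ball ?_
      rw [hε, div_le_one (by positivity)]
      linarith [Nat.cast_nonneg (α := ℝ) n]
    simp_rw [h2] at h1
    have h3 := ENNReal.Tendsto.const_mul (ENNReal.Tendsto.const_mul h1 (Or.inr hC))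
      (Or.inr (ENNReal.ofReal_ne_top (r := ‖S‖)))
    simpa using h3
  have hunif : TendstoUniformly P (potential S h) atTop := by
    rw [Metric.tendstoUniformly_iff]
    intro η hη
    filter_upwards [hball.eventually_lt_const (ENNReal.ofReal_pos.2 hη)] with n hn x
    rw [← ENNReal.ofReal_lt_ofReal_iff hη, ← edist_dist, edist_eq_enorm_sub]
    refine lt_of_le_of_lt ?_ hn
    have hsub : potential S h x - P n x =
        ∫ y, (kernelMap S (x - y) (h y) - (max ‖x - y‖ (ε n) ^ 3)⁻¹ • S (x - y) (h y)) :=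
      (integral_sub (integrable_kernelMap S hi.1 (lintegral_powKernel_two_mul_ne_top hC hi hb x))
        ((hi.norm.const_mul _).mono' (hmeas n x)
          (Eventually.of_forall fun y => hbound n _ _))).symm
    rw [hsub]
    refine (enorm_integral_le_lintegral_enorm _).trans ?_
    calc ∫⁻ y, ‖kernelMap S (x - y) (h y) - (max ‖x - y‖ (ε n) ^ 3)⁻¹ • S (x - y) (h y)‖ₑ
        ≤ ∫⁻ y, ENNReal.ofReal ‖S‖ *
            (C * (ball (0 : Space) (ε n)).indicator (powKernel 2) (x - y)) := by
          refine lintegral_mono_ae ?_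
          filter_upwards [hb] with y hy
          by_cases hz : x - y ∈ ball (0 : Space) (ε n)
          · rw [Set.indicator_of_mem hz]
            have hz' : ‖x - y‖ < ε n := by simpa using hz
            rw [kernelMap, ← sub_smul, max_eq_right hz'.le, mul_comm C]
            refine le_trans ?_ (mul_le_mul_right (mul_le_mul_right hy _) _)
            rw [powKernel_two]
            refine enorm_le_of_norm_le S.opNorm_nonneg (by positivity) ?_
            rcases eq_or_ne ‖x - y‖ 0 with h0 | h0
            · have : x - y = 0 := norm_eq_zero.1 h0
              simp [this]
            have hpos : 0 < ‖x - y‖ := lt_of_le_of_ne (norm_nonneg _) (Ne.symm h0)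
            refine norm_smul_apply_le (sub_nonneg.2 (by gcongr)) S _ _ ?_
            rw [← inv_norm_cube_mul_norm]
            have := hεpos n
            gcongr
            exact sub_le_self _ (by positivity)
          · have hz' : ε n ≤ ‖x - y‖ := by simpa using hz
            rw [kernelMap, max_eq_left hz', sub_self, enorm_zero]
            exact zero_le
      _ = _ := by
          rw [lintegral_const_mul' _ _ ENNReal.ofReal_ne_top, lintegral_const_mul' _ _ hC,
            lintegral_sub_left_eq_self ((ball (0 : Space) (ε n)).indicator (powKernel 2)) x,
            lintegral_indicator measurableSet_ball]
  exact hunif.continuous (Eventually.of_forall hcont).frequently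

/-- `z ↦ |z|⁻³ z` is Lipschitz near the unit sphere, where it is the identity. -/
theorem norm_inv_cube_smul_sub_le {z w : Space} (hw : ‖w‖ = 1) (hzw : ‖z - w‖ ≤ 1 / 2) :
    ‖(‖z‖ ^ 3)⁻¹ • z - w‖ ≤ 46 * ‖z - w‖ := by
  set t := ‖z‖ with ht
  have h1 : |t - 1| ≤ ‖z - w‖ := by rw [← hw]; exact abs_norm_sub_norm_le z w
  have h2 := abs_le.1 (h1.trans hzw)
  have ht0 : 1 / 2 ≤ t := by linarith
  have hinv : (t ^ 3)⁻¹ ≤ 8 := by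
    rw [inv_le_comm₀ (by positivity) (by norm_num)]
    calc (8 : ℝ)⁻¹ = (1 / 2) ^ 3 := by norm_num
      _ ≤ t ^ 3 := by gcongr
  have h3 : |(t ^ 3)⁻¹ - 1| ≤ 38 * ‖z - w‖ := by
    have e : (t ^ 3)⁻¹ - 1 = (t ^ 3)⁻¹ * ((1 + t + t ^ 2) * -(t - 1)) := by
      field_simp; ring
    rw [e, abs_mul, abs_mul, abs_neg, abs_of_nonneg (by positivity), abs_of_nonneg (by positivity)]
    have : 1 + t + t ^ 2 ≤ 19 / 4 := by nlinarith
    calc (t ^ 3)⁻¹ * ((1 + t + t ^ 2) * |t - 1|) ≤ 8 * (19 / 4 * ‖z - w‖) := by gcongr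
      _ = _ := by ring
  have e : (t ^ 3)⁻¹ • z - w = (t ^ 3)⁻¹ • (z - w) + ((t ^ 3)⁻¹ - 1) • w := by
    rw [smul_sub, sub_smul, one_smul]; abel
  rw [e]
  refine (norm_add_le _ _).trans ?_
  rw [norm_smul, norm_smul, hw, mul_one, Real.norm_of_nonneg (by positivity), Real.norm_eq_abs]
  nlinarith [mul_le_mul_of_nonneg_right hinv (norm_nonneg (z - w))]

theorem smul_kernelMap_smul (S : Space →L[ℝ] V →L[ℝ] V) {r : ℝ} (hr : 0 < r) (z : Space) (v : V) :
    r ^ 2 • kernelMap S (r • z) v = kernelMap S z v := by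
  rw [kernelMap, kernelMap, norm_smul, Real.norm_of_nonneg hr.le, map_smul,
    _root_.smul_apply, smul_smul, smul_smul]
  congr 1
  rw [mul_pow, mul_inv]
  field_simp

/-- The limit of `r² ∫ |rω - y|⁻³ S(rω - y) h(y) dy` is `∫ S(ω) h(y) dy`, uniformly in `ω`. In the
region `|y| < r/2` the integrands differ by `O(|y| / r) |h(y)|`; in the region `|y| ≥ r/2` the
decay of `h` gives `O(r^(3-a))`. -/
theorem tendstoUniformly_potential (S : Space →L[ℝ] V →L[ℝ] V) {a : ℝ} (ha : 3 < a) {C : ℝ≥0∞}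
    (hC : C ≠ ∞) (hi : Integrable h) (hb : ∀ᵐ y, ‖h y‖ₑ ≤ C)
    (hd : ∀ᵐ y, ‖h y‖ₑ ≤ C * powKernel a y) :
    TendstoUniformly (fun (r : ℝ) (w : sphere (0 : Space) 1) =>
        r ^ 2 • potential S h (r • (w : Space))) (fun w => ∫ y, S w (h y)) atTop := by
  obtain ⟨D, hD, hDr⟩ := exists_lintegral_powKernel_le (b := 2) (by norm_num) (by norm_num)
  -- `E1` bounds the error where `|y| < r/2`, together with the term `S(ω) h(y)` where `|y| ≥ r/2`;
  -- `E2` bounds the potential of the part of `h` in `|y| ≥ r/2`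
  set E1 : ℝ → ℝ := fun r => ∫ y, 46 * min (‖y‖ / r) (1 / 2) * ‖h y‖ with hE1
  set E2 : ℝ → ℝ≥0∞ := fun r => ENNReal.ofReal (2 ^ (a - 2) * r ^ (3 - a)) * (C * D) with hE2
  set E : ℝ → ℝ≥0∞ := fun r => ENNReal.ofReal ‖S‖ * (ENNReal.ofReal (E1 r) + E2 r) with hE
  have hint : ∀ r : ℝ, 0 < r → Integrable fun y => 46 * min (‖y‖ / r) (1 / 2) * ‖h y‖ := by
    intro r hr
    refine (hi.norm.const_mul 23).mono' ?_ (Eventually.of_forall fun y => ?_)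
    · exact (by fun_prop : Measurable fun y : Space =>
        46 * min (‖y‖ / r) (1 / 2)).aestronglyMeasurable.mul hi.1.norm
    · rw [Real.norm_of_nonneg (by positivity)]
      refine mul_le_mul_of_nonneg_right ?_ (norm_nonneg _)
      linarith [min_le_right (‖y‖ / r) (1 / 2)]
  have hE1t : Tendsto E1 atTop (𝓝 0) := by
    have h0 : (0 : ℝ) = ∫ y : Space, (0 : ℝ) := by simp
    rw [h0]
    refine tendsto_integral_filter_of_dominated_convergence (fun y => 23 * ‖h y‖) ?_ ?_
      (hi.norm.const_mul 23) (Eventually.of_forall fun y => ?_)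
    · filter_upwards [eventually_gt_atTop 0] with r hr using (hint r hr).1
    · filter_upwards [eventually_gt_atTop 0] with r hr
      refine Eventually.of_forall fun y => ?_
      rw [Real.norm_of_nonneg (by positivity)]
      refine mul_le_mul_of_nonneg_right ?_ (norm_nonneg _)
      linarith [min_le_right (‖y‖ / r) (1 / 2)]
    · have h1 : Tendsto (fun r : ℝ => ‖y‖ / r) atTop (𝓝 0) :=
        tendsto_const_nhds.div_atTop tendsto_id
      have h2 : Tendsto (fun r : ℝ => 46 * min (‖y‖ / r) (1 / 2) * ‖h y‖) atTop
          (𝓝 (46 * min 0 (1 / 2) * ‖h y‖)) :=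
        ((h1.min tendsto_const_nhds).const_mul 46).mul_const _
      simpa using h2
  have hE2t : Tendsto E2 atTop (𝓝 0) := by
    have h1 : Tendsto (fun r : ℝ => 2 ^ (a - 2) * r ^ (3 - a)) atTop (𝓝 0) := by
      have := (tendsto_rpow_neg_atTop (show 0 < a - 3 by linarith)).const_mul ((2 : ℝ) ^ (a - 2))
      simpa using this
    have h2 := ENNReal.Tendsto.mul_const (b := C * D) (ENNReal.tendsto_ofReal h1)
      (Or.inr (ENNReal.mul_ne_top hC hD))
    rwa [ENNReal.ofReal_zero, zero_mul] at h2
  have hEt : Tendsto E atTop (𝓝 0) := by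
    have := ENNReal.Tendsto.const_mul (a := ENNReal.ofReal ‖S‖)
      ((ENNReal.tendsto_ofReal hE1t).add hE2t) (Or.inr ENNReal.ofReal_ne_top)
    simpa using this
  rw [Metric.tendstoUniformly_iff]
  intro η hη
  filter_upwards [hEt.eventually_lt_const (ENNReal.ofReal_pos.2 hη), eventually_gt_atTop 0]
    with r hr hr0 w
  have hw : ‖(w : Space)‖ = 1 := by simp
  have hrw0 : r • (w : Space) ≠ 0 := by
    rw [← norm_pos_iff, norm_smul, hw]; simpa using hr0.ne'
  rw [← ENNReal.ofReal_lt_ofReal_iff hη, ← edist_dist, edist_comm, edist_eq_enorm_sub]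
  refine lt_of_le_of_lt ?_ hr
  have hI := integrable_kernelMap S hi.1
    (lintegral_powKernel_two_mul_ne_top hC hi hb (r • (w : Space)))
  have hsub : r ^ 2 • potential S h (r • (w : Space)) - ∫ y, S w (h y) =
      ∫ y, (r ^ 2 • kernelMap S (r • (w : Space) - y) (h y) - S w (h y)) := by
    rw [potential, ← integral_smul]
    exact (integral_sub (hI.smul (r ^ 2)) ((S w).integrable_comp hi)).symm
  rw [hsub]
  refine (enorm_integral_le_lintegral_enorm _).trans ?_
  have hpt : ∀ᵐ y, ‖r ^ 2 • kernelMap S (r • (w : Space) - y) (h y) - S w (h y)‖ₑ ≤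
      ENNReal.ofReal ‖S‖ * (ENNReal.ofReal (46 * min (‖y‖ / r) (1 / 2) * ‖h y‖) +
        ENNReal.ofReal (r ^ 2 * (r / 2) ^ (2 - a)) * C *
          (powKernel 2 (r • (w : Space) - y) * powKernel 2 y)) := by
    filter_upwards [hd] with y hy
    set z : Space := (w : Space) - r⁻¹ • y with hz
    have hrz : r • (w : Space) - y = r • z := by
      rw [hz, smul_sub, smul_smul, mul_inv_cancel₀ hr0.ne', one_smul]
    have hzw : ‖z - w‖ = ‖y‖ / r := by
      rw [hz, sub_sub_cancel_left, norm_neg, norm_smul, norm_inv, Real.norm_of_nonneg hr0.le]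
      ring
    rcases lt_or_ge (‖y‖ / r) (1 / 2) with hlt | hge
    · rw [hrz, smul_kernelMap_smul S hr0]
      refine le_trans ?_ (mul_le_mul_right le_self_add _)
      rw [min_eq_left hlt.le, ← ENNReal.ofReal_mul S.opNorm_nonneg, ← ofReal_norm]
      refine ENNReal.ofReal_le_ofReal ?_
      have e : kernelMap S z (h y) - S w (h y) = S ((‖z‖ ^ 3)⁻¹ • z - w) (h y) := by
        rw [map_sub, map_smul]; rfl
      rw [e]
      refine (S.le_opNorm₂ _ _).trans ?_
      rw [mul_assoc]
      gcongr
      rw [← hzw] at hlt ⊢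
      exact norm_inv_cube_smul_sub_le hw hlt.le
    · have hyr : r / 2 ≤ ‖y‖ := by
        rw [le_div_iff₀ hr0] at hge; linarith
      have hy0 : y ≠ 0 := norm_pos_iff.1 (by linarith [half_pos hr0])
      refine (enorm_sub_le).trans ?_
      rw [add_comm, mul_add]
      refine add_le_add ?_ ?_
      · rw [min_eq_right hge, ← ENNReal.ofReal_mul S.opNorm_nonneg, ← ofReal_norm]
        refine ENNReal.ofReal_le_ofReal ((S.le_opNorm₂ _ _).trans ?_)
        rw [hw]
        nlinarith [mul_nonneg S.opNorm_nonneg (norm_nonneg (h y))]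
      · rw [enorm_smul]
        refine (mul_le_mul_right (enorm_kernelMap_le S _ _) _).trans ?_
        -- the power `|y|⁻²` is kept, so that the integral against the kernel is still `O(1 / r)`
        have h1 : ‖h y‖ₑ ≤ C * (ENNReal.ofReal ((r / 2) ^ (2 - a)) * powKernel 2 y) := by
          refine hy.trans (mul_le_mul_right ?_ _)
          have e : a = (a - 2) + 2 := by ring
          rw [e, powKernel_add hy0]
          refine mul_le_mul_left ((powKernel_le_of_le (by linarith) (half_pos hr0) hyr).trans
            (le_of_eq ?_)) _
          congr 2; ring
        refine (mul_le_mul_right (mul_le_mul_right (mul_le_mul_right h1 _) _) _).trans (le_of_eq ?_)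
        rw [Real.enorm_of_nonneg (by positivity), ENNReal.ofReal_mul (p := r ^ 2) (by positivity)]
        ring
  refine (lintegral_mono_ae hpt).trans ?_
  rw [lintegral_const_mul' _ _ ENNReal.ofReal_ne_top]
  refine mul_le_mul_right ?_ _
  rw [lintegral_add_right _ (by fun_prop), ofReal_integral_eq_lintegral_ofReal (hint r hr0)
    (Eventually.of_forall fun y => by positivity)]
  refine add_le_add le_rfl ?_
  rw [lintegral_const_mul _ (by fun_prop)]
  refine (mul_le_mul_right (hDr _ hrw0) _).trans (le_of_eq ?_)
  have e : r ^ 2 * (r / 2) ^ (2 - a) * r ^ (-(2 - 1 : ℝ)) = 2 ^ (a - 2) * r ^ (3 - a) := by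
    rw [Real.div_rpow hr0.le two_pos.le, div_eq_mul_inv, ← Real.rpow_neg two_pos.le,
      ← Real.rpow_natCast r 2]
    have : r ^ (3 - a) = r ^ ((2 : ℕ) : ℝ) * r ^ (2 - a) * r ^ (-(2 - 1 : ℝ)) := by
      rw [← Real.rpow_add hr0, ← Real.rpow_add hr0]
      congr 1; push_cast; ring
    rw [this, neg_sub]
    ring
  rw [hE2]
  simp only
  rw [← e, powKernel, norm_smul, hw, mul_one, Real.norm_of_nonneg hr0.le,
    ENNReal.ofReal_mul (p := r ^ 2 * (r / 2) ^ (2 - a)) (by positivity)]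
  ring

end Potential

/-! ### Integration by parts against smooth square integrable functions -/

section IntegrationByParts

open Topology

variable {ι : Type} [Fintype ι]

theorem integrable_smul_L2 {φ : Space → ℝ} (hφ : MemLp φ 2 volume) (f : L2 ι) :
    Integrable fun x => φ x • f x :=
  memLp_one_iff_integrable.1 ((Lp.memLp f).smul hφ)

/-- The defining identity of a weak derivative, for a real test function of compact support. -/
theorem IsWeakDeriv.integral_smul_of_hasCompactSupport {m : Space} {f g : L2 ι}
    (h : IsWeakDeriv m f g) {φ : Space → ℝ} (hφ : ContDiff ℝ (⊤ : ℕ∞) φ)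
    (hc : HasCompactSupport φ) : ∫ x, φ x • g x = -∫ x, fderiv ℝ φ x m • f x := by
  have hφ' : ContDiff ℝ (⊤ : ℕ∞) (fun x => (φ x : ℂ)) := Complex.ofRealCLM.contDiff.comp hφ
  have hc' : HasCompactSupport (fun x => (φ x : ℂ)) :=
    hc.comp_left (g := fun t : ℝ => (t : ℂ)) Complex.ofReal_zero
  have h1 := isWeakDeriv_iff.1 h (hc'.toSchwartzMap hφ')
  have h2 : ∀ x, (∂_{m} (hc'.toSchwartzMap hφ')) x = ((fderiv ℝ φ x m : ℝ) : ℂ) := by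
    intro x
    rw [SchwartzMap.lineDerivOp_apply_eq_fderiv]
    have hd : HasFDerivAt (fun x => (φ x : ℂ)) (Complex.ofRealCLM ∘L fderiv ℝ φ x) x :=
      Complex.ofRealCLM.hasFDerivAt.comp x
        (hφ.differentiable (by simp) x).hasFDerivAt
    change fderiv ℝ (fun x => (φ x : ℂ)) x m = _
    rw [hd.fderiv]; rfl
  simp only [h2] at h1
  exact h1

/-- The compact support of the test function can be replaced by square integrability of the test
function and of its derivative; the cutoffs `χ(x/(n+1))` have uniformly bounded derivatives. -/
theorem IsWeakDeriv.integral_smul {m : Space} {f g : L2 ι} (h : IsWeakDeriv m f g)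
    {φ : Space → ℝ} (hφ : ContDiff ℝ (⊤ : ℕ∞) φ) (h2 : MemLp φ 2 volume)
    (hd2 : MemLp (fun x => fderiv ℝ φ x m) 2 volume) :
    ∫ x, φ x • g x = -∫ x, fderiv ℝ φ x m • f x := by
  let χ : ContDiffBump (0 : Space) := ⟨1, 2, one_pos, one_lt_two⟩
  have hχ : ContDiff ℝ (⊤ : ℕ∞) χ := χ.contDiff
  obtain ⟨K, hK⟩ : ∃ K, ∀ x, ‖fderiv ℝ χ x‖ ≤ K := by
    obtain ⟨x₀, hx₀⟩ :=
      ((hχ.continuous_fderiv (by simp)).norm).exists_forall_ge_of_hasCompactSupport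
      (χ.hasCompactSupport.fderiv (𝕜 := ℝ)).norm
    exact ⟨_, hx₀⟩
  have hK0 : 0 ≤ K := (norm_nonneg _).trans (hK 0)
  set c : ℕ → ℝ := fun n => ((n : ℝ) + 1)⁻¹ with hc
  have hc0 : ∀ n, 0 < c n := fun n => by positivity
  have hc1 : ∀ n, c n ≤ 1 := fun n =>
    inv_le_one_of_one_le₀ (by linarith [Nat.cast_nonneg (α := ℝ) n])
  have hct : Tendsto c atTop (𝓝 0) := by
    simpa [hc, one_div] using tendsto_one_div_add_atTop_nhds_zero_nat (𝕜 := ℝ)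
  have hχd : ∀ n x, HasFDerivAt (fun x => χ (c n • x)) (c n • fderiv ℝ χ (c n • x)) x := by
    intro n x
    have h1 : HasFDerivAt (fun x : Space => c n • x) (c n • ContinuousLinearMap.id ℝ Space) x :=
      (hasFDerivAt_id x).const_smul (c n)
    have h3 := ((hχ.differentiable (by simp)) (c n • x)).hasFDerivAt.comp x h1
    refine h3.congr_fderiv ?_
    ext v; simp
  have hprod : ∀ n x, fderiv ℝ (fun x => χ (c n • x) * φ x) x m =
      χ (c n • x) * fderiv ℝ φ x m + φ x * (c n * fderiv ℝ χ (c n • x) m) := by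
    intro n x
    change fderiv ℝ ((fun x => χ (c n • x)) * φ) x m = _
    rw [((hχd n x).mul ((hφ.differentiable (by simp)) x).hasFDerivAt).fderiv]
    simp
  have hsupp : ∀ n, HasCompactSupport fun x => χ (c n • x) := fun n =>
    χ.hasCompactSupport.comp_homeomorph (Homeomorph.smulOfNeZero (c n) (hc0 n).ne')
  have hn : ∀ n, ∫ x, (χ (c n • x) * φ x) • g x =
      -∫ x, (χ (c n • x) * fderiv ℝ φ x m + φ x * (c n * fderiv ℝ χ (c n • x) m)) • f x := by
    intro n
    have hcd : ContDiff ℝ (⊤ : ℕ∞) fun x => χ (c n • x) * φ x :=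
      (hχ.comp (contDiff_const_smul (c n))).mul hφ
    rw [h.integral_smul_of_hasCompactSupport hcd ((hsupp n).mul_right)]
    simp_rw [hprod]
  have hχ1 : ∀ x : Space, Tendsto (fun n => χ (c n • x)) atTop (𝓝 1) := by
    intro x
    have h1 : Tendsto (fun n => c n • x) atTop (𝓝 0) := by simpa using hct.smul_const x
    have h3 := (hχ.continuous.tendsto 0).comp h1
    rwa [χ.one_of_mem_closedBall (by simp [χ])] at h3
  have hχle : ∀ x, ‖χ x‖ ≤ 1 := fun x => by
    rw [Real.norm_of_nonneg χ.nonneg]; exact χ.le_one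
  have hχc : ∀ n, Continuous fun x : Space => χ (c n • x) := fun n =>
    hχ.continuous.comp (continuous_const_smul _)
  have hdc : Continuous fun x => fderiv ℝ φ x m :=
    (hφ.continuous_fderiv (by simp)).clm_apply continuous_const
  have hχdc : ∀ n, Continuous fun x : Space => fderiv ℝ χ (c n • x) m := fun n =>
    ((hχ.continuous_fderiv (by simp)).comp (continuous_const_smul _)).clm_apply continuous_const
  have L1 : Tendsto (fun n => ∫ x, (χ (c n • x) * φ x) • g x) atTop (𝓝 (∫ x, φ x • g x)) := by
    refine tendsto_integral_of_dominated_convergence (fun x => ‖φ x • g x‖) (fun n => ?_)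
      (integrable_smul_L2 h2 g).norm (fun n => Eventually.of_forall fun x => ?_)
      (Eventually.of_forall fun x => ?_)
    · exact ((hχc n).mul hφ.continuous).aestronglyMeasurable.smul (Lp.aestronglyMeasurable g)
    · rw [mul_smul, norm_smul]
      exact mul_le_of_le_one_left (norm_nonneg _) (hχle _)
    · simpa using ((hχ1 x).mul_const (φ x)).smul_const (g x)
  have L2 : Tendsto (fun n => -∫ x, (χ (c n • x) * fderiv ℝ φ x m
      + φ x * (c n * fderiv ℝ χ (c n • x) m)) • f x) atTop (𝓝 (-∫ x, fderiv ℝ φ x m • f x)) := by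
    refine Tendsto.neg (tendsto_integral_of_dominated_convergence
      (fun x => ‖fderiv ℝ φ x m • f x‖ + K * ‖m‖ * ‖φ x • f x‖) (fun n => ?_)
      ((integrable_smul_L2 hd2 f).norm.add ((integrable_smul_L2 h2 f).norm.const_mul _))
      (fun n => Eventually.of_forall fun x => ?_) (Eventually.of_forall fun x => ?_))
    · exact (((hχc n).mul hdc).add (hφ.continuous.mul
        (continuous_const.mul (hχdc n)))).aestronglyMeasurable.smul (Lp.aestronglyMeasurable f)
    · rw [norm_smul, norm_smul, norm_smul]
      have e1 : ‖χ (c n • x) * fderiv ℝ φ x m‖ ≤ ‖fderiv ℝ φ x m‖ := by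
        rw [norm_mul]; exact mul_le_of_le_one_left (norm_nonneg _) (hχle _)
      have e2 : ‖φ x * (c n * fderiv ℝ χ (c n • x) m)‖ ≤ K * ‖m‖ * ‖φ x‖ := by
        rw [norm_mul, norm_mul, Real.norm_of_nonneg (hc0 n).le, mul_comm]
        refine mul_le_mul_of_nonneg_right ?_ (norm_nonneg _)
        calc c n * ‖fderiv ℝ χ (c n • x) m‖ ≤ 1 * (K * ‖m‖) :=
              mul_le_mul (hc1 n) (ContinuousLinearMap.le_of_opNorm_le _ (hK _) _)
                (norm_nonneg _) zero_le_one
          _ = _ := one_mul _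
      calc _ ≤ (‖fderiv ℝ φ x m‖ + K * ‖m‖ * ‖φ x‖) * ‖f x‖ := by
            gcongr; exact (norm_add_le _ _).trans (add_le_add e1 e2)
        _ = _ := by ring
    · have e1 : Tendsto (fun n => c n * fderiv ℝ χ (c n • x) m) atTop (𝓝 0) := by
        refine squeeze_zero_norm (a := fun n => c n * (K * ‖m‖)) (fun n => ?_) ?_
        · rw [norm_mul, Real.norm_of_nonneg (hc0 n).le]
          exact mul_le_mul_of_nonneg_left (ContinuousLinearMap.le_of_opNorm_le _ (hK _) _)
            (hc0 n).le
        · simpa using hct.mul_const (K * ‖m‖)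
      simpa using (((hχ1 x).mul_const (fderiv ℝ φ x m)).add (e1.const_mul (φ x))).smul_const (f x)
  exact tendsto_nhds_unique L1 (by simpa only [hn] using L2)

end IntegrationByParts

/-! ### The regularised fundamental solution -/

section Regularised

/-- The `k`-th component of `z ↦ (|z|² + t)^(-3/2) z` at `z = x - y`, as a function of `y`; up to a
factor it is the gradient of the regularised Newton potential `(|z|² + t)^(-1/2)`. -/
def regKernel (t : ℝ) (k : Fin 3) (x y : Space) : ℝ :=
  (‖x - y‖ ^ 2 + t) ^ (-(3 / 2) : ℝ) * (x - y) k

variable {t : ℝ}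

theorem hasFDerivAt_regKernel (ht : 0 < t) (k : Fin 3) (x y : Space) :
    HasFDerivAt (regKernel t k x)
      ((3 * (‖x - y‖ ^ 2 + t) ^ (-(5 / 2) : ℝ) * (x - y) k) • innerSL ℝ (x - y)
        - (‖x - y‖ ^ 2 + t) ^ (-(3 / 2) : ℝ) • (EuclideanSpace.proj k : Space →L[ℝ] ℝ)) y := by
  have h0 : HasFDerivAt (fun y : Space => x - y) (-ContinuousLinearMap.id ℝ Space) y :=
    (hasFDerivAt_id y).const_sub x
  have h1 := h0.norm_sq.add_const t
  have hq : ‖x - y‖ ^ 2 + t ≠ 0 := by positivity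
  have h2 := h1.rpow_const (p := -(3 / 2)) (Or.inl hq)
  have h3 : HasFDerivAt (fun y : Space => (x - y) k)
      ((EuclideanSpace.proj k : Space →L[ℝ] ℝ) ∘L (-ContinuousLinearMap.id ℝ Space)) y :=
    (EuclideanSpace.proj k : Space →L[ℝ] ℝ).hasFDerivAt.comp y h0
  refine (h2.mul h3).congr_fderiv ?_
  ext v
  have e : (-(3 / 2) - 1 : ℝ) = -(5 / 2) := by norm_num
  simp [e]
  ring

theorem fderiv_regKernel_single (ht : 0 < t) (k j : Fin 3) (x y : Space) :
    fderiv ℝ (regKernel t k x) y (EuclideanSpace.single j 1) =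
      3 * (‖x - y‖ ^ 2 + t) ^ (-(5 / 2) : ℝ) * (x - y) k * (x - y) j
        - (‖x - y‖ ^ 2 + t) ^ (-(3 / 2) : ℝ) * (if k = j then 1 else 0) := by
  rw [(hasFDerivAt_regKernel ht k x y).fderiv]
  simp [EuclideanSpace.inner_single_right]

theorem contDiff_regKernel (ht : 0 < t) (k : Fin 3) (x : Space) :
    ContDiff ℝ (⊤ : ℕ∞) (regKernel t k x) := by
  have h0 : ContDiff ℝ (⊤ : ℕ∞) fun y : Space => x - y := contDiff_const.sub contDiff_id
  refine ContDiff.mul (ContDiff.rpow_const_of_ne ((h0.norm_sq ℝ).add contDiff_const)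
    fun y => by positivity) ?_
  exact (EuclideanSpace.proj k : Space →L[ℝ] ℝ).contDiff.comp h0

theorem memLp_inv_norm_sq_add (ht : 0 < t) (ht1 : t ≤ 1) (x : Space) :
    MemLp (fun y : Space => (‖x - y‖ ^ 2 + t)⁻¹) 2 volume := by
  have hcont : Continuous fun y : Space => (‖x - y‖ ^ 2 + t)⁻¹ :=
    Continuous.inv₀ (by fun_prop) fun y => by positivity
  rw [memLp_two_iff_integrable_sq hcont.aestronglyMeasurable]
  have h1 : Integrable fun z : Space => (1 + ‖z‖ ^ 2) ^ (-(4 : ℝ) / 2) :=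
    integrable_rpow_neg_one_add_norm_sq (by simp; norm_num)
  refine ((h1.comp_sub_left x).const_mul (t⁻¹ ^ 2)).mono' (hcont.pow 2).aestronglyMeasurable
    (Eventually.of_forall fun y => ?_)
  have e : (1 + ‖x - y‖ ^ 2) ^ (-(4 : ℝ) / 2) = ((1 + ‖x - y‖ ^ 2)⁻¹) ^ 2 := by
    rw [show (-(4 : ℝ) / 2) = -((2 : ℕ) : ℝ) by norm_num, Real.rpow_neg (by positivity),
      Real.rpow_natCast, inv_pow]
  rw [Real.norm_of_nonneg (by positivity), e, ← mul_pow, ← mul_inv]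
  gcongr
  nlinarith [sq_nonneg ‖x - y‖]

theorem rpow_neg_three_halves_mul_le {q z : ℝ} (hq : 0 < q) (hz : |z| ≤ √q) :
    q ^ (-(3 / 2) : ℝ) * |z| ≤ q⁻¹ := by
  calc q ^ (-(3 / 2) : ℝ) * |z| ≤ q ^ (-(3 / 2) : ℝ) * √q := by gcongr
    _ = q⁻¹ := by
      rw [Real.sqrt_eq_rpow, ← Real.rpow_add hq, ← Real.rpow_neg_one]; norm_num

theorem norm_le_sqrt_norm_sq_add (ht : 0 < t) (z : Space) : ‖z‖ ≤ √(‖z‖ ^ 2 + t) :=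
  Real.le_sqrt_of_sq_le (by linarith)

theorem abs_apply_le_norm (z : Space) (k : Fin 3) : |z k| ≤ ‖z‖ := PiLp.norm_apply_le z k

theorem memLp_regKernel (ht : 0 < t) (ht1 : t ≤ 1) (k : Fin 3) (x : Space) :
    MemLp (regKernel t k x) 2 volume := by
  refine (memLp_inv_norm_sq_add ht ht1 x).mono
    (contDiff_regKernel ht k x).continuous.aestronglyMeasurable
    (Eventually.of_forall fun y => ?_)
  have hq : 0 < ‖x - y‖ ^ 2 + t := by positivity
  rw [regKernel, norm_mul, Real.norm_of_nonneg (Real.rpow_nonneg hq.le _), Real.norm_eq_abs,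
    Real.norm_of_nonneg (by positivity)]
  exact rpow_neg_three_halves_mul_le hq
    ((abs_apply_le_norm _ k).trans (norm_le_sqrt_norm_sq_add ht _))

theorem memLp_fderiv_regKernel (ht : 0 < t) (ht1 : t ≤ 1) (k j : Fin 3) (x : Space) :
    MemLp (fun y => fderiv ℝ (regKernel t k x) y (EuclideanSpace.single j 1)) 2 volume := by
  have hcont : Continuous fun y => fderiv ℝ (regKernel t k x) y (EuclideanSpace.single j 1) :=
    ((contDiff_regKernel ht k x).continuous_fderiv (by simp)).clm_apply continuous_const
  refine ((memLp_inv_norm_sq_add ht ht1 x).const_mul (4 * (√t)⁻¹)).mono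
    hcont.aestronglyMeasurable (Eventually.of_forall fun y => ?_)
  set q := ‖x - y‖ ^ 2 + t with hq_def
  have hq : 0 < q := by positivity
  have h32 : q ^ (-(3 / 2) : ℝ) ≤ (√t)⁻¹ * q⁻¹ := by
    have e : q ^ (-(3 / 2) : ℝ) = (√q)⁻¹ * q⁻¹ := by
      rw [Real.sqrt_eq_rpow, ← Real.rpow_neg hq.le, ← Real.rpow_neg_one, ← Real.rpow_add hq]
      norm_num
    rw [e]
    gcongr
    linarith [sq_nonneg ‖x - y‖]
  have h52 : q ^ (-(5 / 2) : ℝ) * ‖x - y‖ ^ 2 ≤ q ^ (-(3 / 2) : ℝ) := by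
    calc q ^ (-(5 / 2) : ℝ) * ‖x - y‖ ^ 2 ≤ q ^ (-(5 / 2) : ℝ) * q := by
          gcongr; linarith
      _ = q ^ (-(3 / 2) : ℝ) := by
          nth_rewrite 2 [← Real.rpow_one q]
          rw [← Real.rpow_add hq]; norm_num
  have hk := abs_apply_le_norm (x - y) k
  have hj := abs_apply_le_norm (x - y) j
  have hp5 : 0 ≤ q ^ (-(5 / 2) : ℝ) := Real.rpow_nonneg hq.le _
  have hp3 : 0 ≤ q ^ (-(3 / 2) : ℝ) := Real.rpow_nonneg hq.le _
  rw [fderiv_regKernel_single ht, ← hq_def,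
    Real.norm_of_nonneg (show 0 ≤ 4 * (√t)⁻¹ * q⁻¹ by positivity)]
  refine (norm_sub_le _ _).trans ?_
  have e1 : ‖3 * q ^ (-(5 / 2) : ℝ) * (x - y) k * (x - y) j‖ ≤ 3 * q ^ (-(3 / 2) : ℝ) := by
    rw [norm_mul, norm_mul, Real.norm_of_nonneg (by positivity), Real.norm_eq_abs, Real.norm_eq_abs]
    calc 3 * q ^ (-(5 / 2) : ℝ) * |(x - y) k| * |(x - y) j|
        ≤ 3 * q ^ (-(5 / 2) : ℝ) * ‖x - y‖ * ‖x - y‖ := by gcongr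
      _ = 3 * (q ^ (-(5 / 2) : ℝ) * ‖x - y‖ ^ 2) := by ring
      _ ≤ _ := by gcongr
  have e2 : ‖q ^ (-(3 / 2) : ℝ) * (if k = j then (1 : ℝ) else 0)‖ ≤ q ^ (-(3 / 2) : ℝ) := by
    rw [norm_mul, Real.norm_of_nonneg hp3]
    refine mul_le_of_le_one_right hp3 ?_
    split_ifs <;> simp
  calc _ ≤ 3 * q ^ (-(3 / 2) : ℝ) + q ^ (-(3 / 2) : ℝ) := add_le_add e1 e2
    _ = 4 * q ^ (-(3 / 2) : ℝ) := by ring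
    _ ≤ 4 * ((√t)⁻¹ * q⁻¹) := by gcongr
    _ = _ := by ring

end Regularised

/-! ### The Pauli matrices and the regularised representation formula -/

section Pauli

/-- The matrix `σ_j` as a real-linear map on two-spinors. -/
def pauliMap (j : Fin 3) : Spinor (Fin 2) →L[ℝ] Spinor (Fin 2) :=
  (Matrix.toEuclideanCLM (n := Fin 2) (𝕜 := ℂ) (pauli j)).restrictScalars ℝ

/-- The map `z ↦ σ·z`, with values in the real-linear maps on two-spinors. -/
def sigma : Space →L[ℝ] Spinor (Fin 2) →L[ℝ] Spinor (Fin 2) :=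
  ∑ j, (EuclideanSpace.proj j : Space →L[ℝ] ℝ).smulRight (pauliMap j)

theorem sigma_apply (z : Space) (v : Spinor (Fin 2)) : sigma z v = ∑ j, z j • pauliMap j v := by
  simp [sigma]

theorem pauliMap_smul (j : Fin 3) (c : ℂ) (v : Spinor (Fin 2)) :
    pauliMap j (c • v) = c • pauliMap j v :=
  (Matrix.toEuclideanCLM (n := Fin 2) (𝕜 := ℂ) (pauli j)).map_smul c v

theorem pauliMap_apply (j : Fin 3) (v : Spinor (Fin 2)) (i : Fin 2) :
    pauliMap j v i = ∑ k, pauli j i k * v k := rfl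

theorem pauliMap_pauliMap (j : Fin 3) (v : Spinor (Fin 2)) : pauliMap j (pauliMap j v) = v := by
  ext i
  fin_cases j <;> fin_cases i <;> simp [pauliMap_apply, pauli, ← mul_assoc]

/-- The relation `(σ·z)² = |z|²`. -/
theorem sigma_sigma (z : Space) (v : Spinor (Fin 2)) : sigma z (sigma z v) = ‖z‖ ^ 2 • v := by
  have hz : ((‖z‖ ^ 2 : ℝ) : ℂ) = (z 0 : ℂ) ^ 2 + (z 1 : ℂ) ^ 2 + (z 2 : ℂ) ^ 2 := by
    rw [EuclideanSpace.real_norm_sq_eq, Fin.sum_univ_three]; push_cast; rfl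
  have hI := Complex.I_sq
  ext i
  rw [← Complex.coe_smul, hz]
  fin_cases i
  · simp [sigma_apply, Fin.sum_univ_three, pauliMap_apply, pauli]
    linear_combination (-(z 1 : ℂ) ^ 2 * v 0) * hI
  · simp [sigma_apply, Fin.sum_univ_three, pauliMap_apply, pauli]
    linear_combination (-(z 1 : ℂ) ^ 2 * v 1) * hI

theorem sum_sum_pauliMap (a b : ℝ) (z : Space) (v : Spinor (Fin 2)) :
    ∑ k, ∑ j, (a * z k * z j - b * (if k = j then 1 else 0)) • pauliMap k (pauliMap j v) =
      (a * ‖z‖ ^ 2 - 3 * b) • v := by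
  have h1 : ∑ k, ∑ j, (a * z k * z j) • pauliMap k (pauliMap j v) = (a * ‖z‖ ^ 2) • v := by
    rw [mul_smul, ← sigma_sigma]
    simp only [sigma_apply, Finset.smul_sum, map_sum, map_smul, smul_smul, mul_assoc]
    rw [Finset.sum_comm]
    exact Finset.sum_congr rfl fun j _ => Finset.sum_congr rfl fun k _ => by
      rw [mul_comm (z k) (z j)]
  have h2 : ∑ k, ∑ j, (b * (if k = j then (1 : ℝ) else 0)) • pauliMap k (pauliMap j v) =
      (3 * b) • v := by
    simp [pauliMap_pauliMap, mul_smul]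
    rw [← Nat.cast_smul_eq_nsmul ℝ]
    norm_num
  simp only [sub_smul, Finset.sum_sub_distrib, h1, h2]

end Pauli

/-! ### The representation formula -/

section Representation

open Topology Metric

/-- The approximate identity `3t (|z|² + t)^(-5/2)`, of total mass `4π`. -/
def regDelta (t : ℝ) (z : Space) : ℝ := 3 * t * (‖z‖ ^ 2 + t) ^ (-(5 / 2) : ℝ)

variable {t : ℝ}

/-- Integration by parts of the regularised kernel against `h = ∑ σ_j (1/i) ∂_j ψ`: the
divergence of the regularised kernel is the approximate identity. -/
theorem integral_regularised_sigma {ψ h : L2 (Fin 2)} {G : Fin 3 → L2 (Fin 2)}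
    (hG : ∀ j, IsWeakDeriv (EuclideanSpace.single j 1) ψ (G j))
    (hh : ∀ᵐ y, h y = ∑ j, pauliMap j ((1 / Complex.I) • G j y)) (ht : 0 < t) (ht1 : t ≤ 1)
    (x : Space) :
    ∫ y, (‖x - y‖ ^ 2 + t) ^ (-(3 / 2) : ℝ) • sigma (x - y) (h y) =
      (1 / Complex.I) • ∫ y, regDelta t (x - y) • ψ y := by
  set B : Fin 3 → Fin 3 → Spinor (Fin 2) →L[ℂ] Spinor (Fin 2) := fun k j =>
    Matrix.toEuclideanCLM (n := Fin 2) (𝕜 := ℂ) (pauli k) ∘L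
      Matrix.toEuclideanCLM (n := Fin 2) (𝕜 := ℂ) (pauli j) with hB
  have hBG : ∀ᵐ y, ∀ k j, (B k j).compLp (G j) y = pauliMap k (pauliMap j (G j y)) := by
    simp only [ae_all_iff]
    exact fun k j => (B k j).coeFn_compLp (G j)
  have hBψ : ∀ᵐ y, ∀ k j, (B k j).compLp ψ y = pauliMap k (pauliMap j (ψ y)) := by
    simp only [ae_all_iff]
    exact fun k j => (B k j).coeFn_compLp ψ
  calc ∫ y, (‖x - y‖ ^ 2 + t) ^ (-(3 / 2) : ℝ) • sigma (x - y) (h y)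
      = ∫ y, (1 / Complex.I) • ∑ k, ∑ j, regKernel t k x y • (B k j).compLp (G j) y := by
        refine integral_congr_ae ?_
        filter_upwards [hBG, hh] with y h1 h2
        rw [h2, sigma_apply]
        simp only [h1, map_sum, pauliMap_smul, regKernel, mul_smul, Finset.smul_sum]
        refine Finset.sum_congr rfl fun k _ => Finset.sum_congr rfl fun j _ => ?_
        rw [smul_comm (1 / Complex.I) (_ : ℝ), smul_comm (1 / Complex.I) (_ : ℝ)]
    _ = (1 / Complex.I) • ∑ k, ∑ j, ∫ y, regKernel t k x y • (B k j).compLp (G j) y := by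
        rw [integral_smul, integral_finsetSum]
        · congr 1
          refine Finset.sum_congr rfl fun k _ => integral_finsetSum _ fun j _ => ?_
          exact integrable_smul_L2 (memLp_regKernel ht ht1 k x) _
        · exact fun k _ => integrable_finsetSum _ fun j _ =>
            integrable_smul_L2 (memLp_regKernel ht ht1 k x) _
    _ = (1 / Complex.I) • -∑ k, ∑ j, ∫ y,
          fderiv ℝ (regKernel t k x) y (EuclideanSpace.single j 1) • (B k j).compLp ψ y := by
        simp only [← Finset.sum_neg_distrib]
        congr 1
        refine Finset.sum_congr rfl fun k _ => Finset.sum_congr rfl fun j _ => ?_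
        exact ((hG j).compLp (B k j)).integral_smul (contDiff_regKernel ht k x)
          (memLp_regKernel ht ht1 k x) (memLp_fderiv_regKernel ht ht1 k j x)
    _ = (1 / Complex.I) • -∫ y, ∑ k, ∑ j,
          fderiv ℝ (regKernel t k x) y (EuclideanSpace.single j 1) • (B k j).compLp ψ y := by
        rw [integral_finsetSum]
        · congr 2
          refine Finset.sum_congr rfl fun k _ => (integral_finsetSum _ fun j _ => ?_).symm
          exact integrable_smul_L2 (memLp_fderiv_regKernel ht ht1 k j x) _
        · exact fun k _ => integrable_finsetSum _ fun j _ =>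
            integrable_smul_L2 (memLp_fderiv_regKernel ht ht1 k j x) _
    _ = (1 / Complex.I) • ∫ y, regDelta t (x - y) • ψ y := by
        rw [← integral_neg]
        congr 1
        refine integral_congr_ae ?_
        filter_upwards [hBψ] with y h1
        have hq : 0 < ‖x - y‖ ^ 2 + t := by positivity
        simp only [h1, fderiv_regKernel_single ht, sum_sum_pauliMap, ← neg_smul]
        congr 1
        have e : (‖x - y‖ ^ 2 + t) ^ (-(3 / 2) : ℝ) =
            (‖x - y‖ ^ 2 + t) ^ (-(5 / 2) : ℝ) * (‖x - y‖ ^ 2 + t) := by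
          nth_rewrite 3 [← Real.rpow_one (‖x - y‖ ^ 2 + t)]
          rw [← Real.rpow_add hq]; norm_num
        rw [e, regDelta]
        ring

theorem regDelta_nonneg (ht : 0 ≤ t) (z : Space) : 0 ≤ regDelta t z := by
  unfold regDelta; positivity

theorem continuous_regDelta_one : Continuous (regDelta 1) :=
  continuous_const.mul (Continuous.rpow_const (by fun_prop) fun z => Or.inl (by positivity))

theorem integrable_regDelta_one : Integrable (regDelta 1) := by
  have h1 : Integrable fun z : Space => (1 + ‖z‖ ^ 2) ^ (-(5 : ℝ) / 2) :=
    integrable_rpow_neg_one_add_norm_sq (by simp; norm_num)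
  refine (h1.const_mul 3).congr (Eventually.of_forall fun z => ?_)
  simp only [regDelta]
  rw [add_comm, mul_one, neg_div]

/-- In polar coordinates the radial integrand has the primitive `y³ (y² + 1)^(-3/2)`, which tends
to `1`. -/
theorem integral_regDelta_one : ∫ z, regDelta 1 z = 4 * Real.pi := by
  have hd : ∀ y : ℝ, HasDerivAt (fun y : ℝ => y ^ 3 * (y ^ 2 + 1) ^ (-(3 / 2) : ℝ))
      (y ^ 2 * (3 * 1 * (y ^ 2 + 1) ^ (-(5 / 2) : ℝ))) y := by
    intro y
    have hq : 0 < y ^ 2 + 1 := by positivity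
    have h1 : HasDerivAt (fun y : ℝ => y ^ 2 + 1) (2 * y) y := by
      simpa using (hasDerivAt_pow 2 y).add_const 1
    have h2 := h1.rpow_const (p := -(3 / 2)) (Or.inl hq.ne')
    refine ((hasDerivAt_pow 3 y).mul h2).congr_deriv ?_
    have e : (y ^ 2 + 1) ^ (-(3 / 2) : ℝ) = (y ^ 2 + 1) ^ (-(5 / 2) : ℝ) * (y ^ 2 + 1) := by
      nth_rewrite 3 [← Real.rpow_one (y ^ 2 + 1)]
      rw [← Real.rpow_add hq]; norm_num
    have e2 : (-(3 / 2) - 1 : ℝ) = -(5 / 2) := by norm_num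
    rw [e2, e]
    push_cast
    ring
  have hlim : Tendsto (fun y : ℝ => y ^ 3 * (y ^ 2 + 1) ^ (-(3 / 2) : ℝ)) atTop (𝓝 1) := by
    have h1 : Tendsto (fun y : ℝ => (1 + (y ^ 2)⁻¹) ^ (-(3 / 2) : ℝ)) atTop (𝓝 1) := by
      have h0 : Tendsto (fun y : ℝ => 1 + (y ^ 2)⁻¹) atTop (𝓝 (1 + 0)) :=
        tendsto_const_nhds.add (tendsto_inv_atTop_zero.comp (tendsto_pow_atTop two_ne_zero))
      have := h0.rpow_const (p := -(3 / 2)) (Or.inl (by norm_num))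
      simpa using this
    refine h1.congr' ?_
    filter_upwards [eventually_gt_atTop 0] with y hy
    have e : y ^ 2 + 1 = y ^ 2 * (1 + (y ^ 2)⁻¹) := by field_simp
    rw [e, Real.mul_rpow (by positivity) (by positivity), ← mul_assoc]
    have e2 : y ^ 3 * (y ^ 2) ^ (-(3 / 2) : ℝ) = 1 := by
      rw [← Real.rpow_natCast y 3, ← Real.rpow_natCast y 2, ← Real.rpow_mul hy.le,
        ← Real.rpow_add hy]
      norm_num
    rw [e2, one_mul]
  have hI : ∫ y in Set.Ioi (0 : ℝ), y ^ 2 * (3 * 1 * (y ^ 2 + 1) ^ (-(5 / 2) : ℝ)) = 1 := by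
    rw [integral_Ioi_of_hasDerivAt_of_nonneg' (fun y _ => hd y) (fun y _ => by positivity) hlim]
    simp
  have h := integral_fun_norm_addHaar (volume : Measure Space)
    (fun y : ℝ => 3 * 1 * (y ^ 2 + 1) ^ (-(5 / 2) : ℝ))
  simp only [finrank_euclideanSpace_fin, smul_eq_mul] at h
  change ∫ z : Space, 3 * 1 * (‖z‖ ^ 2 + 1) ^ (-(5 / 2) : ℝ) = _
  rw [h, show 3 - 1 = 2 from rfl, hI, measureReal_def, EuclideanSpace.volume_ball_fin_three]
  simp
  rw [ENNReal.toReal_ofReal (by positivity)]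
  ring

theorem regDelta_smul {ε : ℝ} (hε : 0 < ε) (z : Space) :
    ε ^ 3 * regDelta (ε ^ 2) (ε • z) = regDelta 1 z := by
  have e : ‖ε • z‖ ^ 2 + ε ^ 2 = ε ^ 2 * (‖z‖ ^ 2 + 1) := by
    rw [norm_smul, Real.norm_of_nonneg hε.le]; ring
  have e2 : (ε ^ 2) ^ (-(5 / 2) : ℝ) * ε ^ 5 = 1 := by
    rw [← Real.rpow_natCast ε 5, ← Real.rpow_natCast ε 2, ← Real.rpow_mul hε.le,
      ← Real.rpow_add hε]
    norm_num
  rw [regDelta, regDelta, e, Real.mul_rpow (by positivity) (by positivity)]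
  linear_combination 3 * (‖z‖ ^ 2 + 1) ^ (-(5 / 2) : ℝ) * e2

theorem integral_regDelta_smul {ε : ℝ} (hε : 0 < ε) (f : Space → Spinor (Fin 2)) (x : Space) :
    ∫ y, regDelta (ε ^ 2) (x - y) • f y = ∫ w, regDelta 1 w • f (x - ε • w) := by
  have h1 : ∫ y, regDelta (ε ^ 2) (x - y) • f y = ∫ z, regDelta (ε ^ 2) z • f (x - z) := by
    rw [← integral_sub_left_eq_self (fun z => regDelta (ε ^ 2) z • f (x - z)) volume x]
    simp
  have h2 := Measure.integral_comp_smul (volume : Measure Space)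
    (fun z => regDelta (ε ^ 2) z • f (x - z)) ε
  rw [h1]
  have h3 : ∀ w, regDelta 1 w • f (x - ε • w) =
      ε ^ 3 • (regDelta (ε ^ 2) (ε • w) • f (x - ε • w)) := fun w => by
    rw [smul_smul, regDelta_smul hε]
  simp_rw [h3]
  rw [integral_smul, h2, finrank_euclideanSpace_fin, abs_of_pos (by positivity), smul_smul,
    mul_inv_cancel₀ (by positivity), one_smul]

theorem integrable_norm_sq_L2 {ι : Type} [Fintype ι] (f : L2 ι) : Integrable fun x => ‖f x‖ ^ 2 :=
  (memLp_two_iff_integrable_sq_norm (Lp.aestronglyMeasurable f)).1 (Lp.memLp f)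

/-- The approximate identity converges weakly, tested against continuous functions of compact
support. -/
theorem tendsto_integral_regDelta {θ : Space → ℝ} (hθ : Continuous θ) (hc : HasCompactSupport θ)
    (ψ : L2 (Fin 2)) {ε : ℕ → ℝ} (hε : ∀ n, 0 < ε n) (hε0 : Tendsto ε atTop (𝓝 0)) :
    Tendsto (fun n => ∫ x, θ x • ∫ y, regDelta (ε n ^ 2) (x - y) • ψ y) atTop
      (𝓝 ((4 * Real.pi) • ∫ x, θ x • ψ x)) := by
  -- by Fubini the integral is a mean of the correlation `G` at the scale `ε n`
  set G : Space → Spinor (Fin 2) := fun z => ∫ x, θ x • ψ (x - z) with hGdef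
  have hθ2 : MemLp θ 2 volume := hθ.memLp_of_hasCompactSupport hc
  have hψm : StronglyMeasurable (ψ : Space → Spinor (Fin 2)) := Lp.stronglyMeasurable ψ
  have hθi : Integrable fun x => θ x ^ 2 :=
    (memLp_two_iff_integrable_sq hθ.aestronglyMeasurable).1 hθ2
  have hψi := integrable_norm_sq_L2 ψ
  set K : ℝ := (∫ x, θ x ^ 2) + ∫ x, ‖ψ x‖ ^ 2 with hK
  have hbd : ∀ z x, ‖θ x • ψ (x - z)‖ ≤ θ x ^ 2 + ‖ψ (x - z)‖ ^ 2 := by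
    intro z x
    rw [norm_smul, ← sq_abs (θ x), ← Real.norm_eq_abs]
    nlinarith [sq_nonneg (‖θ x‖ - ‖ψ (x - z)‖), sq_nonneg (‖θ x‖), sq_nonneg ‖ψ (x - z)‖]
  have hbi : ∀ z, Integrable fun x => θ x ^ 2 + ‖ψ (x - z)‖ ^ 2 := fun z =>
    hθi.add (hψi.comp_sub_right z)
  have hbK : ∀ z, ∫ x, (θ x ^ 2 + ‖ψ (x - z)‖ ^ 2) = K := fun z => by
    rw [integral_add hθi (hψi.comp_sub_right z),
      integral_sub_right_eq_self (fun x => ‖ψ x‖ ^ 2) z]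
  have hsi : ∀ z, Integrable fun x => θ x • ψ (x - z) := fun z =>
    (hbi z).mono' (hθ.aestronglyMeasurable.smul
      (hψm.comp_measurable (measurable_id.sub_const z)).aestronglyMeasurable)
      (Eventually.of_forall fun x => hbd z x)
  have hnK : ∀ z, ∫ x, ‖θ x • ψ (x - z)‖ ≤ K := fun z => by
    rw [← hbK z]
    exact integral_mono (hsi z).norm (hbi z) (hbd z)
  have hGK : ∀ z, ‖G z‖ ≤ K := fun z => (norm_integral_le_integral_norm _).trans (hnK z)
  have hjoint : ∀ n, StronglyMeasurable fun p : Space × Space =>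
      θ p.1 • regDelta 1 p.2 • ψ (p.1 - ε n • p.2) := fun n =>
    (hθ.comp continuous_fst).stronglyMeasurable.smul
      ((continuous_regDelta_one.comp continuous_snd).stronglyMeasurable.smul
        (hψm.comp_measurable (measurable_fst.sub (measurable_snd.const_smul (ε n)))))
  have hprod : ∀ n, Integrable (fun p : Space × Space =>
      θ p.1 • regDelta 1 p.2 • ψ (p.1 - ε n • p.2)) ((volume : Measure Space).prod volume) := by
    intro n
    rw [integrable_prod_iff' (hjoint n).aestronglyMeasurable]
    refine ⟨Eventually.of_forall fun w => ?_, ?_⟩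
    · simp_rw [smul_comm (θ _) (regDelta 1 w)]
      exact (hsi (ε n • w)).smul (regDelta 1 w)
    · refine (integrable_regDelta_one.mul_const K).mono'
        (hjoint n).norm.integral_prod_left'.aestronglyMeasurable
        (Eventually.of_forall fun w => ?_)
      rw [Real.norm_of_nonneg (integral_nonneg fun x => norm_nonneg _)]
      simp_rw [smul_comm (θ _) (regDelta 1 w), norm_smul (regDelta 1 w),
        Real.norm_of_nonneg (regDelta_nonneg zero_le_one w)]
      rw [integral_const_mul]
      exact mul_le_mul_of_nonneg_left (hnK _) (regDelta_nonneg zero_le_one w)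
  have hswap : ∀ n, ∫ x, θ x • ∫ y, regDelta (ε n ^ 2) (x - y) • ψ y =
      ∫ w, regDelta 1 w • G (ε n • w) := by
    intro n
    simp_rw [integral_regDelta_smul (hε n), ← integral_smul]
    rw [integral_integral_swap (hprod n)]
    refine integral_congr_ae (Eventually.of_forall fun w => ?_)
    simp only [smul_comm (θ _) (regDelta 1 w), hGdef]
    rw [integral_smul]
  have hGm : StronglyMeasurable G := by
    have : StronglyMeasurable fun p : Space × Space => θ p.2 • ψ (p.2 - p.1) :=
      (hθ.comp continuous_snd).stronglyMeasurable.smul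
        (hψm.comp_measurable (measurable_snd.sub measurable_fst))
    exact this.integral_prod_right'
  -- the translation is moved to the continuous factor `θ`, whose shifts have a common support
  have hG0 : ContinuousAt G 0 := by
    have hshift : ∀ z, G z = ∫ x, θ (x + z) • ψ x := fun z => by
      rw [hGdef]
      simp only
      rw [← integral_add_right_eq_self (fun x => θ x • ψ (x - z)) z]
      simp
    obtain ⟨R, hR⟩ := hc.isCompact.isBounded.subset_closedBall (0 : Space)
    obtain ⟨x₀, hx₀⟩ := hθ.norm.exists_forall_ge_of_hasCompactSupport hc.norm
    have hbound : Integrable ((closedBall (0 : Space) (R + 1)).indicator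
        fun x => ‖θ x₀‖ * ‖ψ x‖) := by
      rw [integrable_indicator_iff measurableSet_closedBall]
      exact (((Lp.memLp ψ).locallyIntegrable (by norm_num)).integrableOn_isCompact
        (isCompact_closedBall _ _)).norm.const_mul _
    rw [funext hshift]
    refine continuousAt_of_dominated (Eventually.of_forall fun z => ?_) ?_ hbound
      (Eventually.of_forall fun x => ?_)
    · exact (hθ.comp (continuous_add_const z)).aestronglyMeasurable.smul
        (Lp.aestronglyMeasurable ψ)
    · filter_upwards [ball_mem_nhds (0 : Space) one_pos] with z hz
      refine Eventually.of_forall fun x => ?_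
      by_cases hx : x ∈ closedBall (0 : Space) (R + 1)
      · rw [Set.indicator_of_mem hx, norm_smul]
        exact mul_le_mul_of_nonneg_right (hx₀ _) (norm_nonneg _)
      · have : θ (x + z) = 0 := by
          refine image_eq_zero_of_notMem_tsupport fun hmem => hx ?_
          have h1 : ‖x + z‖ ≤ R := by simpa using hR hmem
          have h2 : ‖z‖ < 1 := by simpa using hz
          have h3 : ‖x‖ ≤ ‖x + z‖ + ‖z‖ := by simpa using norm_sub_le (x + z) z
          simpa using h3.trans (by linarith)
        rw [Set.indicator_of_notMem hx, this, zero_smul, norm_zero]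
    · exact ((hθ.comp (continuous_const_add x)).smul continuous_const).continuousAt
  simp_rw [hswap]
  have hlim : (4 * Real.pi) • ∫ x, θ x • ψ x = ∫ w, regDelta 1 w • G 0 := by
    rw [integral_smul_const, integral_regDelta_one]
    simp [hGdef]
  rw [hlim]
  refine tendsto_integral_of_dominated_convergence (fun w => regDelta 1 w * K) (fun n => ?_)
    (integrable_regDelta_one.mul_const K) (fun n => Eventually.of_forall fun w => ?_)
    (Eventually.of_forall fun w => ?_)
  · exact continuous_regDelta_one.aestronglyMeasurable.smul
      (hGm.comp_measurable (measurable_id.const_smul (ε n))).aestronglyMeasurable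
  · rw [norm_smul, Real.norm_of_nonneg (regDelta_nonneg zero_le_one w)]
    exact mul_le_mul_of_nonneg_left (hGK _) (regDelta_nonneg zero_le_one w)
  · have h1 : Tendsto (fun n => ε n • w) atTop (𝓝 0) := by simpa using hε0.smul_const w
    exact (hG0.tendsto.comp h1).const_smul (regDelta 1 w)

theorem measurable_riesz {u : Space → ℝ≥0∞} (hu : Measurable u) :
    Measurable fun x => ∫⁻ y, powKernel 2 (x - y) * u y :=
  Measurable.lintegral_prod_right' (f := fun p : Space × Space =>
    powKernel 2 (p.1 - p.2) * u p.2) (by fun_prop)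

/-- The Riesz potential of a square integrable function is integrable against weights in `L¹ ∩ L²`,
in particular locally integrable. -/
theorem lintegral_mul_riesz_ne_top {u θ : Space → ℝ≥0∞} (hu : Measurable u) (hθ : Measurable θ)
    (hu2 : ∫⁻ y, u y ^ 2 ≠ ∞) (hθ1 : ∫⁻ y, θ y ≠ ∞) (hθ2 : ∫⁻ y, θ y ^ 2 ≠ ∞) :
    ∫⁻ x, θ x * ∫⁻ y, powKernel 2 (x - y) * u y ≠ ∞ := by
  set N := (∫⁻ z, farKernel 4 z) + ∫⁻ y, u y ^ 2 with hN
  have hN' : N ≠ ∞ := ENNReal.add_ne_top.2 ⟨lintegral_farKernel_ne_top (by norm_num), hu2⟩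
  have hk := lintegral_nearKernel_ne_top (a := 2) (by norm_num)
  have hm1 : Measurable fun p : Space × Space => nearKernel 2 (p.1 - p.2) * θ p.1 ^ 2 := by fun_prop
  have hm2 : Measurable fun p : Space × Space => nearKernel 2 (p.1 - p.2) * u p.2 ^ 2 := by fun_prop
  have h1 : ∫⁻ x, θ x * ∫⁻ y, powKernel 2 (x - y) * u y ≤
      ∫⁻ x, (((∫⁻ y, nearKernel 2 (x - y) * θ x ^ 2) + ∫⁻ y, nearKernel 2 (x - y) * u y ^ 2)
        + θ x * N) := by
    refine lintegral_mono fun x => ?_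
    simp_rw [← nearKernel_add_farKernel, add_mul]
    rw [lintegral_add_left (by fun_prop), mul_add]
    refine add_le_add ?_ (mul_le_mul_right (lintegral_farKernel_mul_le u x) _)
    rw [← lintegral_const_mul _ (by fun_prop), ← lintegral_add_left (by fun_prop)]
    refine lintegral_mono fun y => ?_
    rw [← mul_add]
    calc θ x * (nearKernel 2 (x - y) * u y) = nearKernel 2 (x - y) * (θ x * u y) := by ring
      _ ≤ _ := mul_le_mul_right (mul_le_sq_add_sq _ _) _
  refine ne_top_of_le_ne_top ?_ h1
  have e1 : Measurable fun x => ∫⁻ y, nearKernel 2 (x - y) * θ x ^ 2 := hm1.lintegral_prod_right'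
  have e2 : Measurable fun x => ∫⁻ y, nearKernel 2 (x - y) * u y ^ 2 := hm2.lintegral_prod_right'
  have e12 : Measurable fun x => (∫⁻ y, nearKernel 2 (x - y) * θ x ^ 2)
      + ∫⁻ y, nearKernel 2 (x - y) * u y ^ 2 := e1.add e2
  rw [lintegral_add_left e12, lintegral_add_left e1, lintegral_mul_const _ hθ]
  refine ENNReal.add_ne_top.2 ⟨ENNReal.add_ne_top.2 ⟨?_, ?_⟩, ENNReal.mul_ne_top hθ1 hN'⟩
  · have : ∀ x, ∫⁻ y, nearKernel 2 (x - y) * θ x ^ 2 = (∫⁻ z, nearKernel 2 z) * θ x ^ 2 :=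
      fun x => by
      rw [lintegral_mul_const _ (by fun_prop), lintegral_sub_left_eq_self (nearKernel 2) x]
    simp_rw [this]
    rw [lintegral_const_mul _ (by fun_prop)]
    exact ENNReal.mul_ne_top hk hθ2
  · rw [lintegral_lintegral_swap (by fun_prop)]
    have : ∀ y, ∫⁻ x, nearKernel 2 (x - y) * u y ^ 2 = (∫⁻ z, nearKernel 2 z) * u y ^ 2 :=
      fun y => by
      rw [lintegral_mul_const _ (by fun_prop), lintegral_sub_right_eq_self (nearKernel 2) y]
    simp_rw [this]
    rw [lintegral_const_mul _ (by fun_prop)]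
    exact ENNReal.mul_ne_top hk hu2

/-- Local integrability enters through the weight `(1 + |x|)⁻⁴`, which is positive and belongs to
`L¹ ∩ L²`. -/
theorem ae_riesz_ne_top {u : Space → ℝ≥0∞} (hu : Measurable u) (hu2 : ∫⁻ y, u y ^ 2 ≠ ∞) :
    ∀ᵐ x, ∫⁻ y, powKernel 2 (x - y) * u y ≠ ∞ := by
  set θ : Space → ℝ≥0∞ := fun x => ENNReal.ofReal ((1 + ‖x‖) ^ (-(4 : ℝ))) with hθ
  have hθm : Measurable θ := by fun_prop
  have hθ1 : ∫⁻ y, θ y ≠ ∞ := (finite_integral_one_add_norm (by simp; norm_num)).ne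
  have hle : ∀ x, θ x ≤ 1 := fun x => by
    rw [hθ, ENNReal.ofReal_le_one]
    exact Real.rpow_le_one_of_one_le_of_nonpos (by linarith [norm_nonneg x]) (by norm_num)
  have hθ2 : ∫⁻ y, θ y ^ 2 ≠ ∞ := ne_top_of_le_ne_top hθ1
    (lintegral_mono fun x => pow_le_of_le_one zero_le (hle x) two_ne_zero)
  have h := ae_lt_top (hθm.mul (measurable_riesz hu))
    (lintegral_mul_riesz_ne_top hu hθm hu2 hθ1 hθ2)
  filter_upwards [h] with x hx htop
  have hpos : θ x ≠ 0 := by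
    rw [hθ]
    exact (ENNReal.ofReal_pos.2 (by positivity)).ne'
  rw [Pi.mul_apply, htop, ENNReal.mul_top hpos] at hx
  exact lt_irrefl _ hx

theorem lintegral_enorm_sq_L2_ne_top {ι : Type} [Fintype ι] (f : L2 ι) : ∫⁻ y, ‖f y‖ₑ ^ 2 ≠ ∞ := by
  have h := (integrable_norm_sq_L2 f).2
  rw [hasFiniteIntegral_iff_enorm] at h
  simpa [enorm_pow] using h.ne

theorem enorm_potential_le {V : Type*} [NormedAddCommGroup V] [NormedSpace ℝ V]
    (S : Space →L[ℝ] V →L[ℝ] V) (h : Space → V) (x : Space) :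
    ‖potential S h x‖ₑ ≤ ENNReal.ofReal ‖S‖ * ∫⁻ y, powKernel 2 (x - y) * ‖h y‖ₑ := by
  rw [← lintegral_const_mul' _ _ ENNReal.ofReal_ne_top]
  exact (enorm_integral_le_lintegral_enorm _).trans
    (lintegral_mono fun y => enorm_kernelMap_le S _ _)

theorem norm_le_of_enorm_le_mul {V : Type*} [NormedAddCommGroup V] {v : V} {c : ℝ} (hc : 0 ≤ c)
    {a : ℝ≥0∞} (ha : a ≠ ∞) (h : ‖v‖ₑ ≤ ENNReal.ofReal c * a) : ‖v‖ ≤ c * a.toReal := by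
  have h2 := ENNReal.toReal_mono (ENNReal.mul_ne_top ENNReal.ofReal_ne_top ha) h
  rwa [toReal_enorm, ENNReal.toReal_mul, ENNReal.toReal_ofReal hc] at h2

section

variable {V : Type*} [NormedAddCommGroup V] [NormedSpace ℝ V]

theorem stronglyMeasurable_prod_smul_apply (S : Space →L[ℝ] V →L[ℝ] V) {h : Space → V}
    (hm : StronglyMeasurable h) {c : Space → ℝ} (hc : Measurable c) :
    StronglyMeasurable fun p : Space × Space => c (p.1 - p.2) • S (p.1 - p.2) (h p.2) :=
  (hc.comp (measurable_fst.sub measurable_snd)).stronglyMeasurable.smul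
    (S.continuous₂.comp_stronglyMeasurable ((continuous_fst.sub
      continuous_snd).stronglyMeasurable.prodMk (hm.comp_measurable measurable_snd)))

theorem stronglyMeasurable_potential (S : Space →L[ℝ] V →L[ℝ] V) {h : Space → V}
    (hm : StronglyMeasurable h) : StronglyMeasurable (potential S h) :=
  (stronglyMeasurable_prod_smul_apply S hm (c := fun z => (‖z‖ ^ 3)⁻¹)
    (by fun_prop)).integral_prod_right'

/-- The potential with the regularised kernel `(|z|² + t)^(-3/2) S(z)`. -/
def regPotential (S : Space →L[ℝ] V →L[ℝ] V) (t : ℝ) (h : Space → V) (x : Space) : V :=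
  ∫ y, (‖x - y‖ ^ 2 + t) ^ (-(3 / 2) : ℝ) • S (x - y) (h y)

theorem stronglyMeasurable_regPotential (S : Space →L[ℝ] V →L[ℝ] V) (t : ℝ) {h : Space → V}
    (hm : StronglyMeasurable h) : StronglyMeasurable (regPotential S t h) :=
  (stronglyMeasurable_prod_smul_apply S hm (c := fun z => (‖z‖ ^ 2 + t) ^ (-(3 / 2) : ℝ))
    (by fun_prop)).integral_prod_right'

theorem enorm_regularised_smul_le (S : Space →L[ℝ] V →L[ℝ] V) (ht : 0 < t) (z : Space) (v : V) :
    ‖(‖z‖ ^ 2 + t) ^ (-(3 / 2) : ℝ) • S z v‖ₑ ≤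
      ENNReal.ofReal ‖S‖ * (powKernel 2 z * ‖v‖ₑ) := by
  rw [powKernel_two]
  rcases eq_or_ne z 0 with rfl | hz
  · simp
  have hz' : 0 < ‖z‖ := norm_pos_iff.2 hz
  have hq : 0 < ‖z‖ ^ 2 + t := by positivity
  refine enorm_le_of_norm_le S.opNorm_nonneg (by positivity)
    (norm_smul_apply_le (by positivity) S z v ?_)
  have h1 := rpow_neg_three_halves_mul_le hq (z := ‖z‖)
    (by rw [abs_norm]; exact norm_le_sqrt_norm_sq_add ht z)
  rw [abs_norm] at h1
  refine h1.trans ?_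
  gcongr
  exact le_add_of_nonneg_right ht.le

theorem enorm_regPotential_le (S : Space →L[ℝ] V →L[ℝ] V) (ht : 0 < t) (h : Space → V)
    (x : Space) :
    ‖regPotential S t h x‖ₑ ≤ ENNReal.ofReal ‖S‖ * ∫⁻ y, powKernel 2 (x - y) * ‖h y‖ₑ := by
  rw [← lintegral_const_mul' _ _ ENNReal.ofReal_ne_top]
  exact (enorm_integral_le_lintegral_enorm _).trans
    (lintegral_mono fun y => enorm_regularised_smul_le S ht _ _)

theorem tendsto_regPotential (S : Space →L[ℝ] V →L[ℝ] V) {h : Space → V}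
    (hm : StronglyMeasurable h) {ε : ℕ → ℝ} (hε : ∀ n, 0 < ε n) (hε0 : Tendsto ε atTop (𝓝 0))
    {x : Space} (hx : ∫⁻ y, powKernel 2 (x - y) * ‖h y‖ₑ ≠ ∞) :
    Tendsto (fun n => regPotential S (ε n ^ 2) h x) atTop (𝓝 (potential S h x)) := by
  have hmu : Measurable fun y => ‖h y‖ₑ := hm.enorm
  refine tendsto_integral_of_dominated_convergence
    (fun y => ‖S‖ * (powKernel 2 (x - y) * ‖h y‖ₑ).toReal) (fun n => ?_)
    ?_ (fun n => Eventually.of_forall fun y => ?_) (Eventually.of_forall fun y => ?_)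
  · exact aestronglyMeasurable_smul_apply S hm.aestronglyMeasurable
      (c := fun z => (‖z‖ ^ 2 + ε n ^ 2) ^ (-(3 / 2) : ℝ)) (by fun_prop) x
  · exact (integrable_toReal_of_lintegral_ne_top (by fun_prop) hx).const_mul _
  · exact norm_le_of_enorm_le_mul S.opNorm_nonneg
      (ENNReal.mul_ne_top ENNReal.ofReal_ne_top enorm_ne_top)
      (enorm_regularised_smul_le S (pow_pos (hε n) 2) _ _)
  · rcases eq_or_ne (x - y) 0 with h0 | h0
    · simp [kernelMap, h0]
    · have hz' : 0 < ‖x - y‖ := norm_pos_iff.2 h0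
      have h1 : Tendsto (fun n => (‖x - y‖ ^ 2 + ε n ^ 2) ^ (-(3 / 2) : ℝ)) atTop
          (𝓝 ((‖x - y‖ ^ 2 + 0 ^ 2) ^ (-(3 / 2) : ℝ))) :=
        (tendsto_const_nhds.add (hε0.pow 2)).rpow_const (Or.inl (by positivity))
      have e : (‖x - y‖ ^ 2 + 0 ^ 2) ^ (-(3 / 2) : ℝ) = (‖x - y‖ ^ 3)⁻¹ := by
        rw [zero_pow two_ne_zero, add_zero, ← Real.rpow_natCast ‖x - y‖ 2,
          ← Real.rpow_mul hz'.le, ← Real.rpow_natCast ‖x - y‖ 3, ← Real.rpow_neg hz'.le]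
        norm_num
      rw [e] at h1
      exact h1.smul_const _

end

theorem locallyIntegrable_potential {ι : Type} [Fintype ι]
    (S : Space →L[ℝ] Spinor ι →L[ℝ] Spinor ι) (h : L2 ι) :
    LocallyIntegrable (potential S h) := by
  have hu : Measurable fun y => ‖h y‖ₑ := (Lp.stronglyMeasurable h).enorm
  have hu2 := lintegral_enorm_sq_L2_ne_top h
  rw [locallyIntegrable_iff]
  intro k hk
  have hkf : volume k ≠ ∞ := hk.measure_lt_top.ne
  have hki : ∫⁻ y, k.indicator (1 : Space → ℝ≥0∞) y ≠ ∞ := by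
    rwa [lintegral_indicator_one hk.measurableSet]
  have h1 := lintegral_mul_riesz_ne_top hu (measurable_one.indicator hk.measurableSet) hu2 hki
    (by
      refine ne_top_of_le_ne_top hki (lintegral_mono fun y => ?_)
      by_cases hy : y ∈ k <;> simp [hy])
  have h2 : ∫⁻ x in k, ∫⁻ y, powKernel 2 (x - y) * ‖h y‖ₑ ≠ ∞ := by
    rw [← lintegral_indicator hk.measurableSet]
    refine ne_top_of_le_ne_top h1 (lintegral_mono fun y => ?_)
    by_cases hy : y ∈ k <;> simp [hy]
  refine ((integrable_toReal_of_lintegral_ne_top (measurable_riesz hu).aemeasurable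
    h2).const_mul ‖S‖).mono'
    (stronglyMeasurable_potential S (Lp.stronglyMeasurable h)).aestronglyMeasurable ?_
  filter_upwards [ae_restrict_of_ae (ae_riesz_ne_top hu hu2)] with x hx
  exact norm_le_of_enorm_le_mul S.opNorm_nonneg hx (enorm_potential_le S h x)

theorem tendsto_integral_smul_regPotential {ι : Type} [Fintype ι]
    (S : Space →L[ℝ] Spinor ι →L[ℝ] Spinor ι) (h : L2 ι) {ε : ℕ → ℝ} (hε : ∀ n, 0 < ε n)
    (hε0 : Tendsto ε atTop (𝓝 0)) {θ : Space → ℝ} (hθ : Continuous θ) (hc : HasCompactSupport θ) :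
    Tendsto (fun n => ∫ x, θ x • regPotential S (ε n ^ 2) h x) atTop
      (𝓝 (∫ x, θ x • potential S h x)) := by
  have hm : StronglyMeasurable (h : Space → Spinor ι) := Lp.stronglyMeasurable h
  have hu : Measurable fun y => ‖h y‖ₑ := hm.enorm
  have hu2 := lintegral_enorm_sq_L2_ne_top h
  have hθ2 : MemLp θ 2 volume := hθ.memLp_of_hasCompactSupport hc
  have hθi : Integrable θ := hθ.integrable_of_hasCompactSupport hc
  have hθm : Measurable fun x => ‖θ x‖ₑ := hθ.measurable.enorm
  have hfin := lintegral_mul_riesz_ne_top hu hθm hu2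
    (hasFiniteIntegral_iff_enorm.1 hθi.2).ne (by
      have h := ((memLp_two_iff_integrable_sq hθ.aestronglyMeasurable).1 hθ2).2
      rw [hasFiniteIntegral_iff_enorm] at h
      simpa [enorm_pow] using h.ne)
  refine tendsto_integral_of_dominated_convergence
    (fun x => ‖S‖ * (‖θ x‖ₑ * ∫⁻ y, powKernel 2 (x - y) * ‖h y‖ₑ).toReal) (fun n => ?_) ?_
    (fun n => ?_) ?_
  · exact hθ.aestronglyMeasurable.smul (stronglyMeasurable_regPotential S _ hm).aestronglyMeasurable
  · exact (integrable_toReal_of_lintegral_ne_top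
      (hθm.mul (measurable_riesz hu)).aemeasurable hfin).const_mul _
  · filter_upwards [ae_riesz_ne_top hu hu2] with x hx
    have h2 := norm_le_of_enorm_le_mul S.opNorm_nonneg hx
      (enorm_regPotential_le S (pow_pos (hε n) 2) h x)
    rw [norm_smul, ENNReal.toReal_mul, toReal_enorm]
    exact (mul_le_mul_of_nonneg_left h2 (norm_nonneg (θ x))).trans (le_of_eq (by ring))
  · filter_upwards [ae_riesz_ne_top hu hu2] with x hx
    exact (tendsto_regPotential S hm hε hε0 hx).const_smul (θ x)

/-- The representation `ψ = (i/4π) ∫ |x - y|⁻³ σ·(x - y) h(y) dy` of `ψ ∈ H¹` through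
`h = σ·D ψ`. -/
theorem ae_eq_potential {ψ h : L2 (Fin 2)} {G : Fin 3 → L2 (Fin 2)}
    (hG : ∀ j, IsWeakDeriv (EuclideanSpace.single j 1) ψ (G j))
    (hh : ∀ᵐ y, h y = ∑ j, pauliMap j ((1 / Complex.I) • G j y)) :
    ∀ᵐ x, ψ x = (Complex.I / (4 * Real.pi)) • potential sigma h x := by
  set ε : ℕ → ℝ := fun n => 1 / ((n : ℝ) + 1) with hεdef
  have hε : ∀ n, 0 < ε n := fun n => by positivity
  have hε1 : ∀ n, ε n ≤ 1 := fun n => by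
    rw [hεdef, div_le_one (by positivity)]
    linarith [Nat.cast_nonneg (α := ℝ) n]
  have hε0 : Tendsto ε atTop (𝓝 0) := tendsto_one_div_add_atTop_nhds_zero_nat
  have hPeq : ∀ n x, regPotential sigma (ε n ^ 2) h x =
      (1 / Complex.I) • ∫ y, regDelta (ε n ^ 2) (x - y) • ψ y := fun n x =>
    integral_regularised_sigma hG hh (pow_pos (hε n) 2) (pow_le_one₀ (hε n).le (hε1 n)) x
  -- as `t = ε² → 0`, both sides of `hPeq` converge weakly; test functions identify the limits
  have key : ∀ᵐ x, potential sigma h x = (1 / Complex.I) • ((4 * Real.pi) • ψ x) := by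
    have hli : LocallyIntegrable fun x => (1 / Complex.I) • ((4 * Real.pi) • ψ x) :=
      (((Lp.memLp ψ).locallyIntegrable (by norm_num)).smul (4 * Real.pi)).smul (1 / Complex.I)
    refine ae_eq_of_integral_contDiff_smul_eq (locallyIntegrable_potential sigma h) hli
      fun θ hθ hc => ?_
    refine tendsto_nhds_unique
      (tendsto_integral_smul_regPotential sigma h hε hε0 hθ.continuous hc) ?_
    have h1 := (tendsto_integral_regDelta hθ.continuous hc ψ hε hε0).const_smul (1 / Complex.I)
    have e1 : ∀ n, ∫ x, θ x • regPotential sigma (ε n ^ 2) h x =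
        (1 / Complex.I) • ∫ x, θ x • ∫ y, regDelta (ε n ^ 2) (x - y) • ψ y := fun n => by
      rw [← integral_smul]
      refine integral_congr_ae (Eventually.of_forall fun x => ?_)
      simp only [hPeq]
      exact smul_comm _ _ _
    have e2 : ∫ x, θ x • ((1 / Complex.I) • ((4 * Real.pi) • ψ x)) =
        (1 / Complex.I) • ((4 * Real.pi) • ∫ x, θ x • ψ x) := by
      rw [← integral_smul, ← integral_smul]
      refine integral_congr_ae (Eventually.of_forall fun x => ?_)
      simp only
      rw [smul_comm (4 * Real.pi) (θ x), smul_comm (1 / Complex.I) (θ x)]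
    rw [e2]
    simpa only [e1] using h1
  filter_upwards [key] with x hx
  rw [hx, ← Complex.coe_smul, smul_smul, smul_smul]
  have hpi : (Real.pi : ℂ) ≠ 0 := by exact_mod_cast Real.pi_ne_zero
  have : Complex.I / (4 * Real.pi) * (1 / Complex.I) * ((4 * Real.pi : ℝ) : ℂ) = 1 := by
    push_cast
    field_simp
  rw [this, one_smul]

end Representation

/-! ### Zero modes of the Weyl–Dirac operator -/

section ZeroModes

open Topology Metric

variable {A : Space → Space} (hA : AssumptionA1 A)

/-- A zero mode satisfies `σ·D ψ = (σ·A) ψ`; the common value `h` is square integrable. -/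
theorem exists_density_of_mem_kerSub {ψ : L2 (Fin 2)} (hψ : ψ ∈ kerSub (weylDirac hA) 0) :
    ∃ h : L2 (Fin 2), (∀ᵐ y, h y = sigma (A y) (ψ y)) ∧
      ∀ᵐ x, ψ x = (Complex.I / (4 * Real.pi)) • potential sigma h x := by
  obtain ⟨g, hg, rfl⟩ := (mem_kerSub_firstOrderOperator hA).1 hψ
  set h : L2 (Fin 2) := ∑ j, mulMatrix (pauli j) ((1 / Complex.I) • weakDeriv j g) with hh
  have h1 : h = ∑ j, mulMatrix (pauli j) (mulPotential hA j (g : L2 (Fin 2))) := by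
    rw [firstOrderMap_apply, zero_smul, mulMatrix_eq_compLp 0, map_zero, zero_compLp,
      add_zero] at hg
    simp only [map_sub, Finset.sum_sub_distrib] at hg
    exact sub_eq_zero.1 hg
  have hM : ∀ (j : Fin 3) (f : L2 (Fin 2)), ∀ᵐ y, mulMatrix (pauli j) f y = pauliMap j (f y) :=
    fun j f => (Matrix.toEuclideanCLM (n := Fin 2) (𝕜 := ℂ) (pauli j)).coeFn_compLp f
  refine ⟨h, ?_, ae_eq_potential (fun j => isWeakDeriv_weakDeriv j g) ?_⟩
  · have h2 := ae_all_iff.2 fun j => hM j (mulPotential hA j (g : L2 (Fin 2)))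
    have h3 := ae_all_iff.2 fun j => coeFn_mulPotential hA j (g : L2 (Fin 2))
    rw [h1]
    filter_upwards [h2, h3, Lp.coeFn_finsetSum Finset.univ
      (fun j => mulMatrix (pauli j) (mulPotential hA j (g : L2 (Fin 2))))] with y e2 e3 e4
    rw [e4, sigma_apply, Finset.sum_apply]
    refine Finset.sum_congr rfl fun j _ => ?_
    rw [e2, e3, Complex.coe_smul, map_smul]
  · have h2 := ae_all_iff.2 fun j => hM j ((1 / Complex.I) • weakDeriv j g)
    have h3 := ae_all_iff.2 fun j => Lp.coeFn_smul (1 / Complex.I) (weakDeriv j g)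
    filter_upwards [h2, h3, Lp.coeFn_finsetSum Finset.univ
      (fun j => mulMatrix (pauli j) ((1 / Complex.I) • weakDeriv j g))] with y e2 e3 e4
    rw [hh, e4, Finset.sum_apply]
    refine Finset.sum_congr rfl fun j _ => ?_
    rw [e2, e3, Pi.smul_apply]

/-- The weight `⟨x⟩^(-ρ)`. -/
def weight (ρ : ℝ) (x : Space) : ℝ≥0∞ := ENNReal.ofReal (Real.sqrt (1 + ‖x‖ ^ 2) ^ (-ρ))

theorem measurable_weight (ρ : ℝ) : Measurable (weight ρ) := by
  unfold weight; fun_prop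

theorem one_le_sqrt_one_add_norm_sq (x : Space) : 1 ≤ Real.sqrt (1 + ‖x‖ ^ 2) :=
  Real.one_le_sqrt.2 (by nlinarith [sq_nonneg ‖x‖])

theorem weight_le_one {ρ : ℝ} (hρ : 0 ≤ ρ) (x : Space) : weight ρ x ≤ 1 := by
  rw [weight, ENNReal.ofReal_le_one]
  exact Real.rpow_le_one_of_one_le_of_nonpos (one_le_sqrt_one_add_norm_sq x) (by linarith)

theorem weight_le_powKernel {a ρ : ℝ} (ha : 0 ≤ a) (h : a ≤ ρ) {x : Space} (hx : x ≠ 0) :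
    weight ρ x ≤ powKernel a x := by
  refine ENNReal.ofReal_le_ofReal ?_
  refine (Real.rpow_le_rpow_of_exponent_le (one_le_sqrt_one_add_norm_sq x)
    (neg_le_neg h)).trans ?_
  exact Real.rpow_le_rpow_of_nonpos (norm_pos_iff.2 hx)
    (Real.le_sqrt_of_sq_le (by linarith)) (by linarith)

theorem AssumptionA1.exists_enorm_le (hA : AssumptionA1 A) :
    ∃ ρ : ℝ, 1 < ρ ∧ ∃ C : ℝ≥0∞, C ≠ ∞ ∧ ∀ x, ‖A x‖ₑ ≤ C * weight ρ x := by
  obtain ⟨ρ, hρ, C, hC, h⟩ := hA.bound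
  refine ⟨ρ, hρ, ENNReal.ofReal (3 * C), ENNReal.ofReal_ne_top, fun x => ?_⟩
  rw [weight, ← ENNReal.ofReal_mul (by positivity), ← ofReal_norm]
  refine ENNReal.ofReal_le_ofReal ?_
  set b := C * Real.sqrt (1 + ‖x‖ ^ 2) ^ (-ρ) with hb
  have hb0 : 0 ≤ b := by positivity
  rw [mul_assoc, ← hb, EuclideanSpace.norm_eq, Fin.sum_univ_three]
  refine Real.sqrt_le_iff.2 ⟨by positivity, ?_⟩
  simp only [Real.norm_eq_abs]
  nlinarith [pow_le_pow_left₀ (abs_nonneg _) (h 0 x) 2, pow_le_pow_left₀ (abs_nonneg _) (h 1 x) 2,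
    pow_le_pow_left₀ (abs_nonneg _) (h 2 x) 2]

/-- For a zero mode, the density `h = (σ·A) ψ` is bounded and decays faster than `|y|⁻³`. The step
`δ = 4 / (2N + 1)` makes `Nδ < 2 < (N + 1)δ`, so that `N` improvements of the decay rate by `δ`
stay clear of the borderline rate `2`. -/
theorem exists_density_bound (hA : AssumptionA1 A) {ψ h : L2 (Fin 2)}
    (hh : ∀ᵐ y, h y = sigma (A y) (ψ y))
    (hψ : ∀ᵐ x, ψ x = (Complex.I / (4 * Real.pi)) • potential sigma h x) :
    ∃ a : ℝ, 3 < a ∧ ∃ C : ℝ≥0∞, C ≠ ∞ ∧ (∀ᵐ y, ‖h y‖ₑ ≤ C) ∧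
      ∀ᵐ y, ‖h y‖ₑ ≤ C * powKernel a y := by
  obtain ⟨ρ, hρ, C, hC, hAC⟩ := hA.exists_enorm_le
  set u : Space → ℝ≥0∞ := fun y => ‖ψ y‖ₑ with hu_def
  have hu : Measurable u := (Lp.stronglyMeasurable ψ).enorm
  have hu2 : ∫⁻ y, u y ^ 2 ≠ ∞ := lintegral_enorm_sq_L2_ne_top ψ
  have hw := measurable_weight ρ
  set s : ℝ≥0∞ := ENNReal.ofReal ‖sigma‖ with hs
  have hs' : s ≠ ∞ := ENNReal.ofReal_ne_top
  have hhu : ∀ᵐ y, ‖h y‖ₑ ≤ s * C * (weight ρ y * u y) := by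
    filter_upwards [hh] with y hy
    have h1 : ‖h y‖ₑ ≤ s * (‖A y‖ₑ * ‖ψ y‖ₑ) := by
      rw [hy, ← ofReal_norm (A y)]
      exact enorm_le_of_norm_le sigma.opNorm_nonneg (norm_nonneg _) (sigma.le_opNorm₂ _ _)
    refine h1.trans ?_
    calc s * (‖A y‖ₑ * ‖ψ y‖ₑ) ≤ s * (C * weight ρ y * ‖ψ y‖ₑ) := by
          gcongr; exact hAC y
      _ = _ := by rw [hu_def]; ring
  set q : ℝ≥0∞ := ‖(Complex.I / (4 * Real.pi) : ℂ)‖ₑ with hq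
  have hq' : q ≠ ∞ := enorm_ne_top
  set M : ℝ≥0∞ := q * (s * (s * C)) with hM
  have hM' : M ≠ ∞ := by finiteness
  have hmain : ∀ᵐ x, u x ≤ M * ∫⁻ y, powKernel 2 (x - y) * (weight ρ y * u y) := by
    filter_upwards [hψ] with x hx
    rw [hu_def]
    simp only
    rw [hx, enorm_smul, hM, mul_assoc, mul_assoc]
    refine mul_le_mul_right ((enorm_potential_le sigma h x).trans (mul_le_mul_right ?_ _)) _
    rw [← lintegral_const_mul _ (by fun_prop)]
    refine lintegral_mono_ae ?_
    filter_upwards [hhu] with y hy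
    exact (mul_le_mul_right hy _).trans (le_of_eq (by ring))
  obtain ⟨B, hB, huB⟩ := exists_ae_le_of_le_riesz hu hu2 hM' (by
    filter_upwards [hmain] with x hx
    refine hx.trans (mul_le_mul_right (lintegral_mono fun y => mul_le_mul_right ?_ _) _)
    exact mul_le_of_le_one_left zero_le (weight_le_one (by linarith) y))
  obtain ⟨N, hN⟩ := exists_nat_ge (2 / (ρ - 1))
  have hρ1 : 0 < ρ - 1 := by linarith
  have hN' : 2 ≤ N * (ρ - 1) := (div_le_iff₀ hρ1).1 hN
  set δ : ℝ := 4 / (2 * N + 1) with hδ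
  have hδ0 : 0 < δ := by positivity
  have hδρ : δ ≤ ρ - 1 := by
    rw [hδ, div_le_iff₀ (by positivity)]; linarith
  have hNδ : N * δ < 2 := by
    rw [hδ, mul_div_assoc', div_lt_iff₀ (by positivity)]; linarith
  have hNδ' : 2 < (N + 1) * δ := by
    rw [hδ, mul_div_assoc', lt_div_iff₀ (by positivity)]; linarith
  have hwδ : ∀ᵐ y, weight ρ y ≤ powKernel (1 + δ) y := by
    filter_upwards [ae_ne_zero] with y hy
    exact weight_le_powKernel (by linarith) (by linarith) hy
  obtain ⟨D, hD, huD⟩ := exists_ae_le_powKernel_of_le_riesz hδ0 hM' hB hwδ huB hmain N hNδ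
  refine ⟨1 + (N + 1) * δ, by linarith, s * C * (B + D), by finiteness, ?_, ?_⟩
  · filter_upwards [hhu, huB] with y h1 h2
    refine h1.trans (mul_le_mul_right ?_ _)
    exact (mul_le_of_le_one_left zero_le (weight_le_one (by linarith) y)).trans
      (h2.trans le_self_add)
  · filter_upwards [hhu, huD, hwδ, ae_ne_zero] with y h1 h2 h3 h4
    refine h1.trans ?_
    have e : 1 + ((N : ℝ) + 1) * δ = (1 + δ) + N * δ := by ring
    rw [e, powKernel_add h4]
    calc s * C * (weight ρ y * u y)
        ≤ s * C * (powKernel (1 + δ) y * (D * powKernel (N * δ) y)) := by gcongr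
      _ = s * C * D * (powKernel (1 + δ) y * powKernel (N * δ) y) := by ring
      _ ≤ _ := by gcongr; exact le_add_self

/-- The product rule `(σ·w)(σ·a) = (w·a) I₂ + i σ·(w × a)`. -/
theorem profileIntegrand_eq (ψ : L2 (Fin 2)) (w y : Space) :
    profileIntegrand A ψ w y = sigma w (sigma (A y) (ψ y)) := by
  have hI := Complex.I_mul_I
  ext i
  fin_cases i
  · simp [profileIntegrand, profileMatrix, sigma_apply, Fin.sum_univ_three, pauliMap_apply, pauli,
      dotProduct, cross_apply]
    linear_combination ((w 0 : ℂ) * A y 2 * ψ y 1 - A y 0 * w 2 * ψ y 1 + w 1 * A y 1 * ψ y 0) * hI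
  · simp [profileIntegrand, profileMatrix, sigma_apply, Fin.sum_univ_three, pauliMap_apply, pauli,
      dotProduct, cross_apply]
    linear_combination ((w 1 : ℂ) * A y 1 * ψ y 1 - A y 2 * w 0 * ψ y 0 + w 2 * A y 0 * ψ y 0) * hI

/-- Every zero mode of `T` has the profile `u_ψ` at infinity. -/
theorem zeroMode_asymptotics {ψ : L2 (Fin 2)} (hψ : ψ ∈ kerSub (weylDirac hA) 0) :
    (∀ w : sphere (0 : Space) 1, Integrable (profileIntegrand A ψ w)) ∧
    Continuous (limitProfile A ψ) ∧
    ∃ F : Space → Spinor (Fin 2), Continuous F ∧ (∀ᵐ x, ψ x = F x) ∧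
      TendstoUniformly (fun (r : ℝ) (w : sphere (0 : Space) 1) => r ^ 2 • F (r • (w : Space)))
        (limitProfile A ψ) atTop := by
  obtain ⟨h, hh, hψh⟩ := exists_density_of_mem_kerSub hA hψ
  obtain ⟨a, ha, C, hC, hb, hd⟩ := exists_density_bound hA hh hψh
  have hi : Integrable h := integrable_of_enorm_le ha hC (Lp.aestronglyMeasurable h) hb hd
  have hprof : ∀ w : Space, (fun y => sigma w (h y)) =ᵐ[volume] profileIntegrand A ψ w := by
    intro w
    filter_upwards [hh] with y hy
    rw [profileIntegrand_eq, hy]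
  have hlim : limitProfile A ψ = fun w : sphere (0 : Space) 1 =>
      (Complex.I / (4 * Real.pi)) • ∫ y, sigma w (h y) := by
    funext w
    rw [limitProfile, integral_congr_ae (hprof w)]
  have hc : Continuous fun v : Spinor (Fin 2) => (Complex.I / (4 * Real.pi) : ℂ) • v :=
    continuous_const_smul _
  refine ⟨fun w => ((sigma w).integrable_comp hi).congr (hprof w), ?_,
    fun x => (Complex.I / (4 * Real.pi)) • potential sigma h x, ?_, hψh, ?_⟩
  · have e : ∀ w : sphere (0 : Space) 1, ∫ y, sigma w (h y) = sigma w (∫ y, h y) := fun w =>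
      (sigma w).integral_comp_comm hi
    rw [hlim]
    simp_rw [e]
    exact hc.comp
      ((sigma.flip (∫ y, h y)).continuous.comp continuous_subtype_val)
  · exact hc.comp (continuous_potential sigma hC hi hb)
  · have h1 : TendstoUniformly (fun (r : ℝ) (w : sphere (0 : Space) 1) =>
        (Complex.I / (4 * Real.pi)) • (r ^ 2 • potential sigma h (r • (w : Space))))
        (fun w => (Complex.I / (4 * Real.pi)) • ∫ y, sigma w (h y)) atTop :=
      (uniformContinuous_const_smul (Complex.I / (4 * Real.pi) : ℂ)).comp_tendstoUniformly
        (tendstoUniformly_potential sigma ha hC hi hb hd)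
    rw [hlim]
    simpa only [smul_comm (Complex.I / (4 * Real.pi) : ℂ) (_ : ℝ)] using h1

/-- The embedding `v ↦ (v, 0)` as a continuous linear map. -/
def upperCLM : Spinor (Fin 2) →L[ℂ] Spinor (Fin 2 ⊕ Fin 2) :=
  LinearMap.toContinuousLinearMap
    { toFun := upper
      map_add' := fun u v => by ext (i | i) <;> simp [upper]
      map_smul' := fun c v => by ext (i | i) <;> simp [upper] }

/-- The embedding `v ↦ (0, v)` as a continuous linear map. -/
def lowerCLM : Spinor (Fin 2) →L[ℂ] Spinor (Fin 2 ⊕ Fin 2) :=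
  LinearMap.toContinuousLinearMap
    { toFun := lower
      map_add' := fun u v => by ext (i | i) <;> simp [lower]
      map_smul' := fun c v => by ext (i | i) <;> simp [lower] }

/-- Transport of the asymptotics of a zero mode along a constant linear embedding. -/
theorem zeroMode_asymptotics_comp (L : Spinor (Fin 2) →L[ℂ] Spinor (Fin 2 ⊕ Fin 2))
    {ψ : L2 (Fin 2)} (hψ : ψ ∈ kerSub (weylDirac hA) 0) {f : L2 (Fin 2 ⊕ Fin 2)}
    (hf : ∀ᵐ x, f x = L (ψ x)) :
    (∀ w : sphere (0 : Space) 1, Integrable (profileIntegrand A ψ w)) ∧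
    Continuous (limitProfile A ψ) ∧
    ∃ F : Space → Spinor (Fin 2 ⊕ Fin 2), Continuous F ∧ (∀ᵐ x, f x = F x) ∧
      TendstoUniformly (fun (r : ℝ) (w : sphere (0 : Space) 1) => r ^ 2 • F (r • (w : Space)))
        (fun w => L (limitProfile A ψ w)) atTop := by
  obtain ⟨h1, h2, F, hF, hψF, hlim⟩ := zeroMode_asymptotics hA hψ
  refine ⟨h1, h2, fun x => L (F x), L.continuous.comp hF, ?_, ?_⟩
  · filter_upwards [hf, hψF] with x e1 e2
    rw [e1, e2]
  · have h3 : TendstoUniformly (fun (r : ℝ) (w : sphere (0 : Space) 1) =>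
        L (r ^ 2 • F (r • (w : Space)))) (fun w => L (limitProfile A ψ w)) atTop :=
      L.uniformContinuous.comp_tendstoUniformly hlim
    simpa only [ContinuousLinearMap.map_smul_of_tower] using h3

end ZeroModes

end WeylDirac

end

theorem mainTheorem2 (A : WeylDirac.Space → WeylDirac.Space) (hA : WeylDirac.AssumptionA1 A)
    (m : ℝ) (hm : 0 < m) :
    (∀ f ∈ WeylDirac.kerSub (WeylDirac.dirac m hA) (m : ℂ),
      ∃ ψ ∈ WeylDirac.kerSub (WeylDirac.weylDirac hA) 0,
        (∀ᵐ x, f x = WeylDirac.upper (ψ x)) ∧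
        (∀ w : Metric.sphere (0 : WeylDirac.Space) 1,
          Integrable (WeylDirac.profileIntegrand A ψ w)) ∧
        Continuous (WeylDirac.limitProfile A ψ) ∧
        ∃ F : WeylDirac.Space → WeylDirac.Spinor (Fin 2 ⊕ Fin 2),
          Continuous F ∧ (∀ᵐ x, f x = F x) ∧
          TendstoUniformly
            (fun (r : ℝ) (w : Metric.sphere (0 : WeylDirac.Space) 1) =>
              r ^ 2 • F (r • (w : WeylDirac.Space)))
            (fun w => WeylDirac.upper (WeylDirac.limitProfile A ψ w)) atTop) ∧
    (∀ f ∈ WeylDirac.kerSub (WeylDirac.dirac m hA) (-(m : ℂ)),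
      ∃ ψ ∈ WeylDirac.kerSub (WeylDirac.weylDirac hA) 0,
        (∀ᵐ x, f x = WeylDirac.lower (ψ x)) ∧
        (∀ w : Metric.sphere (0 : WeylDirac.Space) 1,
          Integrable (WeylDirac.profileIntegrand A ψ w)) ∧
        Continuous (WeylDirac.limitProfile A ψ) ∧
        ∃ F : WeylDirac.Space → WeylDirac.Spinor (Fin 2 ⊕ Fin 2),
          Continuous F ∧ (∀ᵐ x, f x = F x) ∧
          TendstoUniformly
            (fun (r : ℝ) (w : Metric.sphere (0 : WeylDirac.Space) 1) =>
              r ^ 2 • F (r • (w : WeylDirac.Space)))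
            (fun w => WeylDirac.lower (WeylDirac.limitProfile A ψ w)) atTop) := by
  constructor
  · intro f hf
    obtain ⟨ψ, hψ, hfψ⟩ := WeylDirac.exists_upper_of_mem_kerSub_dirac hA hm hf
    exact ⟨ψ, hψ, hfψ, WeylDirac.zeroMode_asymptotics_comp hA WeylDirac.upperCLM hψ hfψ⟩
  · intro f hf
    obtain ⟨ψ, hψ, hfψ⟩ := WeylDirac.exists_lower_of_mem_kerSub_dirac hA hm hf
    exact ⟨ψ, hψ, hfψ, WeylDirac.zeroMode_asymptotics_comp hA WeylDirac.lowerCLM hψ hfψ⟩
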